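/- Let $G$ be a finite simple graph with vertex set $V$. For $v\in V$ let $N[v]$ be the set consisting of $v$ and all its neighbors, and let $\mathcal N[G]=\{N[v] : v\in V\}$ be the closed neighborhood hypergraph of $G$ on the vertex set $V$. The graph $G$ is twin-free if $N[u]\ne N[v]$ for all $u\neq v$. A circular ordering of a finite nonempty set $V$ is a successor relation $\prec$ of the form $v_1\prec v_2\prec\dots\prec v_n\prec v_1$, where $v_1,\dots,v_n$ is an enumeration of $V$ without repetitions; its reversal is the circular ordering $\prec'$ with $u\prec' v$ iff $v\prec u$. An arc of $(V,\prec)$ is the empty set, the whole set $V$, or a set $[a,b]$ consisting of the vertices on the directed path from $a$ to $b$ along $\prec$; an arc that is neither empty nor $V$ determines its endpoints $a$ and $b$. An arc ordering of a hypergraph $\mathcal H$ on $V$ is a circular ordering of $V$ for which every hyperedge of $\mathcal H$ is an arc. It is tight if, for all hyperedges $A,B$ with $\emptyset\ne A\subseteq B\ne V$, the arcs $A$ and $B$ share an endpoint. $G$ is a proper circular-arc (PCA) graph if for some $m$ one can assign to every vertex $v$ an arc $\alpha(v)$ of the circle $1\prec 2\prec\dots\prec m\prec 1$ such that, for all $u\ne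 v$, the vertices $u$ and $v$ are adjacent iff $\alpha(u)\cap\alpha(v)\neq\emptyset$, and $\alpha(u)\not\subseteq\alpha(v)$. **Theorem.** Let $G$ be a finite, twin-free, connected PCA graph, and let $\overline G$ be its complement. 1. If $\overline G$ is non-bipartite, then $\mathcal N[G]$ has an arc ordering, and any two arc orderings of $\mathcal N[G]$ are equal or reversals of each other. 2. If $G$ has at least two vertices and $\overline G$ is bipartite and connected, then $\mathcal N[G]$ has, up to reversal, exactly two tight arc orderings; that is, there are two tight arc orderings of $\mathcal N[G]$, neither equal nor reversals of each other, such that every tight arc ordering of $\mathcal N[G]$ is equal to one of them or to the reversal of one of them. -/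

import Mathlib

open Equiv

namespace CircArc

/-- A circular ordering of `V`, given by its successor map: `u ≺ v` means `σ u = v`.
The map has to run through all of `V` in one single cycle (on a one-point set it is the
identity). The reversed circular ordering is `σ⁻¹`. -/
def IsCircularOrdering {V : Type*} (σ : Perm V) : Prop :=
  σ.IsCycleOn Set.univ

/-- The set of points on the directed path from `a` to `b` along the circular ordering `σ`:
those points reached from `a` without passing through `b` strictly before. -/
def arc {V : Type*} (σ : Perm V) (a b : V) : Set V :=
  {v | ∃ i : ℕ, (σ ^ i) a = v ∧ ∀ j < i, (σ ^ j) a ≠ b}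

/-- Arcs of the circular ordering `σ`, including the empty and the complete one. -/
def IsArc {V : Type*} (σ : Perm V) (A : Set V) : Prop :=
  A = ∅ ∨ A = Set.univ ∨ ∃ a b : V, A = arc σ a b

/-- The arcs `A` and `B` share an endpoint. (Meant for arcs that are neither empty nor
complete; these have uniquely determined endpoints.) -/
def ShareEndpoint {V : Type*} (σ : Perm V) (A B : Set V) : Prop :=
  ∃ a b c d : V, A = arc σ a b ∧ B = arc σ c d ∧ (({a, b} : Set V) ∩ {c, d}).Nonempty

/-- An arc ordering of the hypergraph on the vertex set `V` with the set `H` of hyperedges. -/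
def IsArcOrdering {V : Type*} (H : Set (Set V)) (σ : Perm V) : Prop :=
  IsCircularOrdering σ ∧ ∀ A ∈ H, IsArc σ A

/-- A tight arc ordering. -/
def IsTightArcOrdering {V : Type*} (H : Set (Set V)) (σ : Perm V) : Prop :=
  IsArcOrdering H σ ∧
    ∀ A ∈ H, ∀ B ∈ H, A.Nonempty → A ⊆ B → B ≠ Set.univ → ShareEndpoint σ A B

/-- Equality of circular orderings up to reversal. -/
def EqUpToReversal {V : Type*} (σ τ : Perm V) : Prop :=
  σ = τ ∨ σ = τ⁻¹

/-- The closed neighborhood `N[v]`. -/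
def closedNbhd {V : Type*} (G : SimpleGraph V) (v : V) : Set V :=
  insert v (G.neighborSet v)

/-- The (set of hyperedges of the) closed neighborhood hypergraph `N[G]`. -/
def closedNbhdHypergraph {V : Type*} (G : SimpleGraph V) : Set (Set V) :=
  Set.range (closedNbhd G)

/-- No two distinct vertices have the same closed neighborhood. -/
def TwinFree {V : Type*} (G : SimpleGraph V) : Prop :=
  ∀ u v : V, closedNbhd G u = closedNbhd G v → u = v

/-- `α` is a proper arc representation of `G` on the circle `1 ≺ 2 ≺ ⋯ ≺ m ≺ 1`
(here `Fin m` with its cyclic successor map `finRotate m`). -/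
def IsProperArcRepresentation {V : Type*} (G : SimpleGraph V) (m : ℕ)
    (α : V → Set (Fin m)) : Prop :=
  Function.Injective α ∧
  (∀ v, IsArc (finRotate m) (α v)) ∧
  (∀ u v, u ≠ v → (G.Adj u v ↔ (α u ∩ α v).Nonempty)) ∧
  (∀ u v, u ≠ v → ¬ α u ⊆ α v)

/-- Proper circular-arc graphs. -/
def IsPCA {V : Type*} (G : SimpleGraph V) : Prop :=
  ∃ (m : ℕ) (α : V → Set (Fin m)), IsProperArcRepresentation G m α

end CircArc

/-! The engine is a rigidity statement for tight families of arcs. Say that two hyperedges meet if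
they intersect and do not cover `V`. In a tight ordering an arc `C` meeting `B` arises from `B` by
moving both endpoints weakly in the same direction, one by `|B \ C|` points and the other by `|C \
B|`. These sizes do not depend on the ordering, so only the direction is open. Once one further arc
`A ≠ B` meeting `B` is placed, the sizes of `A ∩ B ∩ C` and of the complement of `A ∪ B ∪ C` decide
the direction (`eq_of_linked`). Propagating this along the meet relation, any two tight orderings
are related, up to reversal, by a permutation preserving every hyperedge of a given component
(`exists_conj_forall_image_eq`).

For existence, sorting vertices by the start points of their arcs gives a round ordering: each
vertex sees an interval ahead and an interval behind, monotonically. Such an ordering is tight, and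
each of these intervals is a clique.

If the complement is not bipartite, `V` is not a union of two cliques. This makes every arc ordering
tight, and the closed neighborhoods form a single component. The permutation then preserves all
closed neighborhoods and is trivial because `G` is twin-free.

If the complement is connected and bipartite with sides `U` and `Uᶜ`, the neighborhoods centered in
`U` are connected under the meet relation, and so are those centered in `Uᶜ`. The permutation `g`
from `U` fixes `Uᶜ` pointwise, the permutation `h` from `Uᶜ` fixes `U` pointwise, and `U` is an arc.
Comparing `g` with `h` leaves two options: nothing moves, or one side is reversed on its own. -/

namespace CircArc

/-! ### Arcs of a circular ordering in coordinates -/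

variable {V : Type*}

/-- The `k` points `a, σ a, …, σ^(k-1) a`. -/
def iv (σ : Perm V) (a : V) (k : ℕ) : Set V := {v | ∃ j < k, (σ ^ j) a = v}

theorem IsCircularOrdering.conj {σ : Perm V} (hσ : IsCircularOrdering σ) (g : Perm V) :
    IsCircularOrdering (g * σ * g⁻¹) := by
  have := Perm.IsCycleOn.conj (g := g) hσ
  rwa [Set.image_univ_of_surjective g.surjective] at this

theorem arc_eq_iv_of_forall {σ : Perm V} {a b : V} {k : ℕ} (hk : (σ ^ k) a = b)
    (hmin : ∀ j < k, (σ ^ j) a ≠ b) : arc σ a b = iv σ a (k + 1) := by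
  ext v
  constructor
  · rintro ⟨i, rfl, hi⟩
    refine ⟨i, ?_, rfl⟩
    by_contra h
    exact hi k (by omega) hk
  · rintro ⟨i, hi, rfl⟩
    exact ⟨i, rfl, fun j hj => hmin j (by omega)⟩

namespace IsCircularOrdering

variable {σ : Perm V}

theorem inv (hσ : IsCircularOrdering σ) : IsCircularOrdering σ⁻¹ := Perm.IsCycleOn.inv hσ

variable [Finite V]

theorem pow_eq_pow_iff (hσ : IsCircularOrdering σ) (a : V) {i j : ℕ} :
    (σ ^ i) a = (σ ^ j) a ↔ i ≡ j [MOD Nat.card V] := by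
  cases nonempty_fintype V
  have h : σ.IsCycleOn ((Finset.univ : Finset V) : Set V) := by
    rw [Finset.coe_univ]; exact hσ
  rw [h.pow_apply_eq_pow_apply (Finset.mem_univ a), Finset.card_univ, Nat.card_eq_fintype_card]

theorem pow_inj (hσ : IsCircularOrdering σ) (a : V) {i j : ℕ} (hi : i < Nat.card V)
    (hj : j < Nat.card V) (h : (σ ^ i) a = (σ ^ j) a) : i = j :=
  Nat.ModEq.eq_of_lt_of_lt ((hσ.pow_eq_pow_iff a).1 h) hi hj

theorem exists_pow (hσ : IsCircularOrdering σ) (a v : V) :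
    ∃ j < Nat.card V, (σ ^ j) a = v := by
  cases nonempty_fintype V
  have h : σ.IsCycleOn ((Finset.univ : Finset V) : Set V) := by
    rw [Finset.coe_univ]; exact hσ
  obtain ⟨j, hj, h⟩ := h.exists_pow_eq (Finset.mem_univ a) (Finset.mem_univ v)
  exact ⟨j, by rwa [Nat.card_eq_fintype_card, ← Finset.card_univ], h⟩

theorem pow_card (hσ : IsCircularOrdering σ) : σ ^ Nat.card V = 1 := by
  ext a
  have := (hσ.pow_eq_pow_iff a (i := Nat.card V) (j := 0)).2 (by simp [Nat.ModEq])
  simpa using this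

/-- A permutation commuting with a circular ordering is a rotation. -/
theorem eq_pow_of_commute (hσ : IsCircularOrdering σ) [Nonempty V] {g : Perm V}
    (hg : g * σ = σ * g) : ∃ k < Nat.card V, g = σ ^ k := by
  obtain ⟨a⟩ := ‹Nonempty V›
  obtain ⟨k, hk, h⟩ := hσ.exists_pow a (g a)
  refine ⟨k, hk, ?_⟩
  ext v
  obtain ⟨j, -, rfl⟩ := hσ.exists_pow a v
  have hc : Commute g (σ ^ j) := Commute.pow_right hg j
  calc g ((σ ^ j) a) = (g * σ ^ j) a := rfl
    _ = (σ ^ j) (g a) := by rw [hc.eq]; rfl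
    _ = (σ ^ j * σ ^ k) a := by rw [← h]; rfl
    _ = (σ ^ k) ((σ ^ j) a) := by rw [← pow_add, add_comm, pow_add]; rfl

theorem inv_pow_apply (hσ : IsCircularOrdering σ) (a : V) {j : ℕ} (hj : j ≤ Nat.card V) :
    (σ⁻¹ ^ j) a = (σ ^ (Nat.card V - j)) a := by
  have h : σ ^ j * σ ^ (Nat.card V - j) = 1 := by
    rw [← pow_add, Nat.add_sub_cancel' hj, hσ.pow_card]
  rw [inv_pow, ← eq_inv_of_mul_eq_one_right h]

/-- The second alternative is the wrap-around past the base point `l`. With this criterion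
statements about arcs become linear arithmetic in positions. -/
theorem pow_mem_iv (hσ : IsCircularOrdering σ) (l : V) {p k j : ℕ} (hp : p ≤ Nat.card V)
    (hk : k ≤ Nat.card V) (hj : j < Nat.card V) :
    (σ ^ j) l ∈ iv σ ((σ ^ p) l) k ↔ (p ≤ j ∧ j < p + k) ∨ j + Nat.card V < p + k := by
  have key : ∀ i, (σ ^ i) ((σ ^ p) l) = (σ ^ (i + p)) l := fun i => by rw [pow_add]; rfl
  constructor
  · rintro ⟨i, hi, h⟩
    rw [key, hσ.pow_eq_pow_iff] at h
    have h2 : i + p < 2 * Nat.card V := by omega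
    rw [Nat.ModEq, Nat.mod_eq_of_lt hj] at h
    rcases Nat.lt_or_ge (i + p) (Nat.card V) with h3 | h3
    · rw [Nat.mod_eq_of_lt h3] at h; omega
    · rw [Nat.mod_eq_sub_mod h3, Nat.mod_eq_of_lt (by omega)] at h; omega
  · rintro (⟨h1, h2⟩ | h1)
    · exact ⟨j - p, by omega, by rw [key, Nat.sub_add_cancel h1]⟩
    · refine ⟨j + Nat.card V - p, by omega, ?_⟩
      rw [key, hσ.pow_eq_pow_iff, Nat.sub_add_cancel (by omega)]
      simp [Nat.ModEq]

theorem pow_mem_iv_self (hσ : IsCircularOrdering σ) (l : V) {k j : ℕ}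
    (hk : k ≤ Nat.card V) (hj : j < Nat.card V) : (σ ^ j) l ∈ iv σ l k ↔ j < k := by
  have := hσ.pow_mem_iv l (Nat.zero_le _) hk hj (p := 0)
  simp only [pow_zero, Perm.coe_one, id] at this
  rw [this]; omega

theorem set_ext (hσ : IsCircularOrdering σ) (l : V) {A B : Set V}
    (h : ∀ j < Nat.card V, (σ ^ j) l ∈ A ↔ (σ ^ j) l ∈ B) : A = B := by
  ext v
  obtain ⟨j, hj, rfl⟩ := hσ.exists_pow l v
  exact h j hj

theorem iv_card (hσ : IsCircularOrdering σ) (l : V) : iv σ l (Nat.card V) = Set.univ :=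
  hσ.set_ext l fun j hj => by simp [hσ.pow_mem_iv_self l le_rfl hj, hj]

theorem iv_ne_univ (hσ : IsCircularOrdering σ) (l : V) {k : ℕ} (hk : k < Nat.card V) :
    iv σ l k ≠ Set.univ := by
  intro h
  have := (hσ.pow_mem_iv_self l hk.le hk).1 (by rw [h]; trivial)
  omega

theorem iv_of_le (hσ : IsCircularOrdering σ) (l : V) {k : ℕ} (hk : Nat.card V ≤ k) :
    iv σ l k = Set.univ := by
  rw [Set.eq_univ_iff_forall]
  intro v
  obtain ⟨j, hj, rfl⟩ := hσ.exists_pow l v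
  exact ⟨j, hj.trans_le hk, rfl⟩

/-- A nonempty proper arc determines its first point and its length. -/
theorem iv_inj (hσ : IsCircularOrdering σ) {a b : V} {k m : ℕ} (hk : 0 < k)
    (hk' : k < Nat.card V) (hm' : m < Nat.card V)
    (h : iv σ a k = iv σ b m) : a = b ∧ k = m := by
  obtain ⟨p, hp, rfl⟩ := hσ.exists_pow a b
  have key : ∀ j < Nat.card V, (j < k ↔ (p ≤ j ∧ j < p + m) ∨ j + Nat.card V < p + m) := by
    intro j hj
    rw [← hσ.pow_mem_iv_self a hk'.le hj, h, hσ.pow_mem_iv a hp.le hm'.le hj]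
  have hp0 : p = 0 := by
    by_contra h0
    have h1 := key 0 (by omega)
    have h2 := key (p - 1) (by omega)
    have h3 := key (Nat.card V - 1) (by omega)
    omega
  subst hp0
  refine ⟨by simp, ?_⟩
  have h1 := key k hk'
  have h2 := key m hm'
  omega

theorem arc_pow (hσ : IsCircularOrdering σ) (a : V) {k : ℕ} (hk : k < Nat.card V) :
    arc σ a ((σ ^ k) a) = iv σ a (k + 1) :=
  arc_eq_iv_of_forall rfl fun j hj h => by
    have := hσ.pow_inj a (by omega) hk h
    omega

theorem exists_arc_eq_iv (hσ : IsCircularOrdering σ) (a b : V) :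
    ∃ k < Nat.card V, (σ ^ k) a = b ∧ arc σ a b = iv σ a (k + 1) := by
  obtain ⟨k, hk, rfl⟩ := hσ.exists_pow a b
  exact ⟨k, hk, rfl, hσ.arc_pow a hk⟩

theorem isArc_iv (hσ : IsCircularOrdering σ) (a : V) (k : ℕ) : IsArc σ (iv σ a k) := by
  rcases Nat.eq_zero_or_pos k with rfl | hk
  · left; ext v; simp [iv]
  rcases Nat.lt_or_ge k (Nat.card V) with h | h
  · refine Or.inr (Or.inr ⟨a, (σ ^ (k - 1)) a, ?_⟩)
    rw [hσ.arc_pow a (by omega), Nat.sub_add_cancel hk]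
  · exact Or.inr (Or.inl (hσ.iv_of_le a h))

theorem exists_iv_of_isArc (hσ : IsCircularOrdering σ) [Nonempty V] {A : Set V}
    (hA : IsArc σ A) : ∃ a k, k ≤ Nat.card V ∧ A = iv σ a k := by
  obtain ⟨v⟩ := ‹Nonempty V›
  rcases hA with rfl | rfl | ⟨a, b, rfl⟩
  · exact ⟨v, 0, Nat.zero_le _, by ext; simp [iv]⟩
  · exact ⟨v, _, le_rfl, (hσ.iv_card v).symm⟩
  · obtain ⟨k, hk, -, h⟩ := hσ.exists_arc_eq_iv a b
    exact ⟨a, k + 1, hk, h⟩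

theorem exists_iv (hσ : IsCircularOrdering σ) {A : Set V} (hA : IsArc σ A)
    (h0 : A.Nonempty) (h1 : A ≠ Set.univ) :
    ∃ a k, 0 < k ∧ k < Nat.card V ∧ A = iv σ a k := by
  have : Nonempty V := ⟨h0.some⟩
  obtain ⟨a, k, hk, rfl⟩ := hσ.exists_iv_of_isArc hA
  refine ⟨a, k, ?_, lt_of_le_of_ne hk ?_, rfl⟩
  · obtain ⟨v, j, hj, -⟩ := h0; omega
  · rintro rfl; exact h1 (hσ.iv_card a)

/-- An arc in the coordinates given by a base point. -/
theorem exists_pow_mem_iff (hσ : IsCircularOrdering σ) (l : V) {A : Set V} (hA : IsArc σ A) :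
    ∃ p k, p < Nat.card V ∧ k ≤ Nat.card V ∧ A = iv σ ((σ ^ p) l) k ∧
      ∀ j < Nat.card V, ((σ ^ j) l ∈ A ↔
        (p ≤ j ∧ j < p + k) ∨ j + Nat.card V < p + k) := by
  have : Nonempty V := ⟨l⟩
  obtain ⟨a, k, hk, rfl⟩ := hσ.exists_iv_of_isArc hA
  obtain ⟨p, hp, rfl⟩ := hσ.exists_pow l a
  exact ⟨p, k, hp, hk, rfl, fun j hj => hσ.pow_mem_iv l hp.le hk hj⟩

theorem isArc_compl (hσ : IsCircularOrdering σ) [Nonempty V] {A : Set V} (hA : IsArc σ A) :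
    IsArc σ Aᶜ := by
  obtain ⟨a, k, hk, rfl⟩ := hσ.exists_iv_of_isArc hA
  have : (iv σ a k)ᶜ = iv σ ((σ ^ k) a) (Nat.card V - k) := hσ.set_ext a fun j hj => by
    rw [Set.mem_compl_iff, hσ.pow_mem_iv_self a hk hj, hσ.pow_mem_iv a hk (by omega) hj]
    omega
  rw [this]
  exact hσ.isArc_iv _ _

theorem isArc_union (hσ : IsCircularOrdering σ) {A B : Set V} (hA : IsArc σ A)
    (hB : IsArc σ B) (hAB : (A ∩ B).Nonempty) : IsArc σ (A ∪ B) := by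
  by_cases hu : A ∪ B = Set.univ
  · exact Or.inr (Or.inl hu)
  -- With a base point outside the union neither arc wraps around, so both become ordinary intervals
  -- of positions.
  obtain ⟨l, hl⟩ := (Set.ne_univ_iff_exists_notMem _).1 hu
  obtain ⟨p, k, hp, hk, hA', hA⟩ := hσ.exists_pow_mem_iff l hA
  obtain ⟨q, m, hq, hm, hB', hB⟩ := hσ.exists_pow_mem_iff l hB
  have hn : 0 < Nat.card V := by omega
  have hA0 := (hA 0 hn).not.1 fun h => hl (Or.inl h)
  have hB0 := (hB 0 hn).not.1 fun h => hl (Or.inr h)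
  obtain ⟨v, hvA, hvB⟩ := hAB
  obtain ⟨j, hj, rfl⟩ := hσ.exists_pow l v
  rw [hA j hj] at hvA
  rw [hB j hj] at hvB
  have : A ∪ B = iv σ ((σ ^ (min p q)) l) (max (p + k) (q + m) - min p q) :=
    hσ.set_ext l fun i hi => by
      rw [Set.mem_union, hA i hi, hB i hi, hσ.pow_mem_iv l (by omega) (by omega) hi]
      omega
  rw [this]
  exact hσ.isArc_iv _ _

/-- Nonempty proper arcs have unique endpoints by `iv_inj`, so the existential over representations
reduces to four equations. -/
theorem shareEndpoint_iv_iff (hσ : IsCircularOrdering σ) {a c : V} {k m : ℕ} (hk : 0 < k)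
    (hk' : k < Nat.card V) (hm : 0 < m) (hm' : m < Nat.card V) :
    ShareEndpoint σ (iv σ a k) (iv σ c m) ↔
      a = c ∨ a = (σ ^ (m - 1)) c ∨ (σ ^ (k - 1)) a = c ∨
        (σ ^ (k - 1)) a = (σ ^ (m - 1)) c := by
  have inter : ∀ x y z w : V, (({x, y} : Set V) ∩ {z, w}).Nonempty ↔
      x = z ∨ x = w ∨ y = z ∨ y = w := by
    intro x y z w
    constructor
    · rintro ⟨v, rfl | rfl, rfl | rfl⟩ <;> simp
    · rintro (rfl | rfl | rfl | rfl)
      exacts [⟨x, by simp⟩, ⟨x, by simp⟩, ⟨y, by simp⟩, ⟨y, by simp⟩]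
  constructor
  · rintro ⟨a', b', c', d', h1, h2, h3⟩
    obtain ⟨i, hi, rfl, h1'⟩ := hσ.exists_arc_eq_iv a' b'
    obtain ⟨j, hj, rfl, h2'⟩ := hσ.exists_arc_eq_iv c' d'
    rw [h1'] at h1
    rw [h2'] at h2
    have hi' : i + 1 < Nat.card V := by
      rcases Nat.lt_or_ge (i + 1) (Nat.card V) with h | h
      · exact h
      · exact absurd (h1.trans (hσ.iv_of_le _ h)) (hσ.iv_ne_univ a hk')
    have hj' : j + 1 < Nat.card V := by
      rcases Nat.lt_or_ge (j + 1) (Nat.card V) with h | h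
      · exact h
      · exact absurd (h2.trans (hσ.iv_of_le _ h)) (hσ.iv_ne_univ c hm')
    obtain ⟨rfl, rfl⟩ := hσ.iv_inj hk hk' hi' h1
    obtain ⟨rfl, rfl⟩ := hσ.iv_inj hm hm' hj' h2
    exact (inter _ _ _ _).1 h3
  · intro h
    refine ⟨a, (σ ^ (k - 1)) a, c, (σ ^ (m - 1)) c, ?_, ?_, (inter _ _ _ _).2 h⟩
    · rw [hσ.arc_pow a (by omega), Nat.sub_add_cancel hk]
    · rw [hσ.arc_pow c (by omega), Nat.sub_add_cancel hm]

theorem arc_inv (hσ : IsCircularOrdering σ) (a b : V) : arc σ⁻¹ b a = arc σ a b := by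
  obtain ⟨k, hk, rfl, h⟩ := hσ.exists_arc_eq_iv a b
  have h1 : (σ⁻¹ ^ k) ((σ ^ k) a) = a := by simp [inv_pow]
  have h2 : ∀ i ≤ k, (σ⁻¹ ^ i) ((σ ^ k) a) = (σ ^ (k - i)) a := by
    intro i hi
    obtain ⟨d, rfl⟩ := Nat.exists_eq_add_of_le hi
    rw [Nat.add_sub_cancel_left, pow_add, inv_pow]
    simp
  rw [h, arc_eq_iv_of_forall (σ := σ⁻¹) h1]
  · ext v
    constructor
    · rintro ⟨i, hi, rfl⟩
      exact ⟨k - i, by omega, (h2 i (by omega)).symm⟩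
    · rintro ⟨i, hi, rfl⟩
      exact ⟨k - i, by omega, by rw [h2 _ (by omega)]; congr 2; omega⟩
  · intro j hj h3
    rw [h2 j hj.le] at h3
    have := hσ.pow_inj a (i := k - j) (j := 0) (by omega) (by omega) h3
    omega

theorem isArc_inv (hσ : IsCircularOrdering σ) {A : Set V} (hA : IsArc σ A) : IsArc σ⁻¹ A := by
  rcases hA with h | h | ⟨a, b, h⟩
  · exact Or.inl h
  · exact Or.inr (Or.inl h)
  · exact Or.inr (Or.inr ⟨b, a, by rw [h, hσ.arc_inv]⟩)

theorem shareEndpoint_inv (hσ : IsCircularOrdering σ) {A B : Set V}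
    (h : ShareEndpoint σ A B) : ShareEndpoint σ⁻¹ A B := by
  obtain ⟨a, b, c, d, h1, h2, h3⟩ := h
  refine ⟨b, a, d, c, by rw [h1, hσ.arc_inv], by rw [h2, hσ.arc_inv], ?_⟩
  rwa [Set.pair_comm b a, Set.pair_comm d c]

end IsCircularOrdering

/-! ### Transport along isomorphisms of circular orderings -/

theorem conj_pow_apply (σ g : Perm V) (j : ℕ) (a : V) :
    ((g * σ * g⁻¹) ^ j) (g a) = g ((σ ^ j) a) := by
  rw [conj_pow]; simp

theorem arc_conj (σ g : Perm V) (a b : V) :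
    arc (g * σ * g⁻¹) (g a) (g b) = g '' arc σ a b := by
  ext v
  simp only [arc, Set.mem_ofPred_eq, Set.mem_image, conj_pow_apply, ne_eq,
    EmbeddingLike.apply_eq_iff_eq]
  constructor
  · rintro ⟨i, rfl, h⟩
    exact ⟨_, ⟨i, rfl, h⟩, rfl⟩
  · rintro ⟨_, ⟨i, rfl, h⟩, rfl⟩
    exact ⟨i, rfl, h⟩

theorem IsArc.conj {σ : Perm V} {A : Set V} (hA : IsArc σ A) (g : Perm V) :
    IsArc (g * σ * g⁻¹) (g '' A) := by
  rcases hA with rfl | rfl | ⟨a, b, rfl⟩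
  · exact Or.inl (Set.image_empty _)
  · exact Or.inr (Or.inl (Set.image_univ_of_surjective g.surjective))
  · exact Or.inr (Or.inr ⟨g a, g b, (arc_conj σ g a b).symm⟩)

theorem ShareEndpoint.conj {σ : Perm V} {A B : Set V} (h : ShareEndpoint σ A B) (g : Perm V) :
    ShareEndpoint (g * σ * g⁻¹) (g '' A) (g '' B) := by
  obtain ⟨a, b, c, d, rfl, rfl, v, hv1, hv2⟩ := h
  refine ⟨g a, g b, g c, g d, (arc_conj ..).symm, (arc_conj ..).symm, g v, ?_, ?_⟩
  · rcases hv1 with rfl | rfl <;> simp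
  · rcases hv2 with rfl | rfl <;> simp

theorem iv_conj (σ g : Perm V) (a : V) (k : ℕ) : iv (g * σ * g⁻¹) (g a) k = g '' iv σ a k := by
  ext v
  simp only [iv, Set.mem_ofPred_eq, Set.mem_image, conj_pow_apply]
  constructor
  · rintro ⟨i, h, rfl⟩
    exact ⟨_, ⟨i, h, rfl⟩, rfl⟩
  · rintro ⟨_, ⟨i, h, rfl⟩, rfl⟩
    exact ⟨i, h, rfl⟩

end CircArc

/-! ### Relative position of linked arcs -/

namespace CircArc

variable {V : Type*}

/-- Two sets are linked if they intersect, do not cover `V`, and share an endpoint whenever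
one of them contains the other. -/
structure Linked (σ : Perm V) (B C : Set V) : Prop where
  inter : (B ∩ C).Nonempty
  union : B ∪ C ≠ Set.univ
  left : B ⊆ C → ShareEndpoint σ B C
  right : C ⊆ B → ShareEndpoint σ C B

namespace IsCircularOrdering

variable [Finite V] {σ τ : Perm V}

theorem eq_or_of_modEq {n i j : ℕ} (h : i ≡ j [MOD n]) (hi : i < 2 * n) (hj : j < 2 * n) :
    i = j ∨ i = j + n ∨ i + n = j := by
  have h1 := Nat.div_add_mod i n
  have h2 := Nat.div_add_mod j n
  have h3 : i / n < 2 := Nat.div_lt_of_lt_mul (by rwa [mul_comm] at hi)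
  have h4 : j / n < 2 := Nat.div_lt_of_lt_mul (by rwa [mul_comm] at hj)
  rw [Nat.ModEq] at h
  interval_cases i / n <;> interval_cases j / n <;> omega

theorem eq_or_of_pow_eq (hσ : IsCircularOrdering σ) (l : V) {i j : ℕ}
    (h : (σ ^ i) l = (σ ^ j) l) (hi : i < 2 * Nat.card V) (hj : j < 2 * Nat.card V) :
    i = j ∨ i = j + Nat.card V ∨ i + Nat.card V = j :=
  eq_or_of_modEq ((hσ.pow_eq_pow_iff l).1 h) hi hj

/-- Coincidences between endpoint positions of arcs that share an endpoint. -/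
theorem shareEndpoint_positions (hσ : IsCircularOrdering σ) (l : V) {p q k m : ℕ}
    (hp : p ≤ Nat.card V) (hq : q ≤ Nat.card V) (hk : 0 < k) (hk' : k < Nat.card V)
    (hm : 0 < m) (hm' : m < Nat.card V)
    (h : ShareEndpoint σ (iv σ ((σ ^ p) l) k) (iv σ ((σ ^ q) l) m)) :
    ∃ i j, (i = p ∨ i = p + k - 1) ∧ (j = q ∨ j = q + m - 1) ∧
      (i = j ∨ i = j + Nat.card V ∨ i + Nat.card V = j) := by
  have key : ∀ i p, (σ ^ i) ((σ ^ p) l) = (σ ^ (i + p)) l := fun i p => by rw [pow_add]; rfl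
  rw [hσ.shareEndpoint_iv_iff hk hk' hm hm', key, key] at h
  rcases h with h | h | h | h <;>
    refine ⟨_, _, ?_, ?_, hσ.eq_or_of_pow_eq l h (by omega) (by omega)⟩ <;> omega

theorem ncard_of_pow_mem_iff (hσ : IsCircularOrdering σ) (l : V) {S : Set V} {p q : ℕ}
    (hq : q ≤ Nat.card V) (h : ∀ j < Nat.card V, ((σ ^ j) l ∈ S ↔ p ≤ j ∧ j < q)) :
    S.ncard = q - p := by
  have hS : S = (fun j => (σ ^ j) l) '' (Finset.Ico p q : Finset ℕ) := by
    ext v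
    obtain ⟨j, hj, rfl⟩ := hσ.exists_pow l v
    rw [h j hj]
    constructor
    · intro hj'
      exact ⟨j, by simpa using hj', rfl⟩
    · rintro ⟨i, hi, hij⟩
      rw [Finset.coe_Ico, Set.mem_Ico] at hi
      rwa [← hσ.pow_inj l (by omega) hj hij]
  rw [hS, Set.InjOn.ncard_image, Set.ncard_coe_finset, Nat.card_Ico]
  intro i hi j hj hij
  rw [Finset.coe_Ico, Set.mem_Ico] at hi hj
  exact hσ.pow_inj l (by omega) (by omega) hij

/-- An arc linked to `iv σ l b` arises from it by moving both endpoints forward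
or both endpoints backward. -/
theorem exists_shift_of_linked (hσ : IsCircularOrdering σ) {l : V} {b : ℕ} (hb : 0 < b)
    (hb' : b < Nat.card V) {C : Set V} (hC : IsArc σ C) (h : Linked σ (iv σ l b) C) :
    ∃ x y, x < b ∧ y < Nat.card V - b ∧
      (C = iv σ ((σ ^ x) l) (b - x + y) ∨
        C = iv σ ((σ ^ (Nat.card V - y)) l) (b - x + y)) := by
  obtain ⟨p, k, hp, hk, hCe, hmem⟩ := hσ.exists_pow_mem_iff l hC
  have hB : ∀ j < Nat.card V, ((σ ^ j) l ∈ iv σ l b ↔ j < b) :=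
    fun j hj => hσ.pow_mem_iv_self l hb'.le hj
  obtain ⟨i, hi, hi1, hi2⟩ : ∃ i < Nat.card V, i < b ∧
      ((p ≤ i ∧ i < p + k) ∨ i + Nat.card V < p + k) := by
    obtain ⟨v, hv1, hv2⟩ := h.inter
    obtain ⟨j, hj, rfl⟩ := hσ.exists_pow l v
    exact ⟨j, hj, (hB j hj).1 hv1, (hmem j hj).1 hv2⟩
  obtain ⟨o, ho, ho1, ho2⟩ : ∃ o < Nat.card V, b ≤ o ∧
      ¬ ((p ≤ o ∧ o < p + k) ∨ o + Nat.card V < p + k) := by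
    obtain ⟨v, hv⟩ := (Set.ne_univ_iff_exists_notMem _).1 h.union
    obtain ⟨j, hj, rfl⟩ := hσ.exists_pow l v
    rw [Set.mem_union, hB j hj, hmem j hj] at hv
    exact ⟨j, hj, by omega, by omega⟩
  have hl : (σ ^ 0) l = l := rfl
  rcases Nat.lt_or_ge (Nat.card V) (p + k) with hw | hw
  -- `C` starts before `l`. If it also passes the end of the base arc, it contains that arc with
  -- room on both sides, against the endpoint condition.
  · rcases Nat.lt_or_ge b (p + k - Nat.card V) with h1 | h1
    · exfalso
      have hsub : iv σ l b ⊆ C := by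
        intro v hv
        obtain ⟨j, hj, rfl⟩ := hσ.exists_pow l v
        rw [hB j hj] at hv
        exact (hmem j hj).2 (by omega)
      have hs := h.left hsub
      rw [hCe] at hs
      obtain ⟨i', j', h2, h3, h4⟩ := hσ.shareEndpoint_positions l (p := 0) (by omega) hp.le hb hb'
        (by omega) (by omega) hs
      omega
    · refine ⟨b - (p + k - Nat.card V), Nat.card V - p, by omega, by omega, Or.inr ?_⟩
      rw [hCe]
      congr 1
      · congr 2; omega
      · omega
  -- If `C` stops before the end of the base arc, it lies inside it. The shared endpoint forces `p =
  -- 0`, a backward shift with `y = 0`, whose start is written `σ ^ Nat.card V` applied to `l`.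
  · rcases Nat.lt_or_ge (p + k) b with h1 | h1
    · have hsub : C ⊆ iv σ l b := by
        intro v hv
        obtain ⟨j, hj, rfl⟩ := hσ.exists_pow l v
        rw [hmem j hj] at hv
        exact (hB j hj).2 (by omega)
      have hs := h.right hsub
      rw [hCe] at hs
      obtain ⟨i', j', h2, h3, h4⟩ := hσ.shareEndpoint_positions l (q := 0) hp.le (by omega)
        (by omega) (by omega) hb hb' hs
      refine ⟨b - k, 0, by omega, by omega, Or.inr ?_⟩
      rw [hCe, Nat.sub_zero, hσ.pow_card]
      have hp0 : p = 0 := by omega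
      subst hp0
      congr 1
      omega
    · refine ⟨p, p + k - b, by omega, by omega, Or.inl ?_⟩
      rw [hCe]
      congr 1
      omega

theorem pow_mem_forward (hσ : IsCircularOrdering σ) (l : V) {b x y j : ℕ} (hx : x < b)
    (hy : y < Nat.card V - b) (hj : j < Nat.card V) :
    (σ ^ j) l ∈ iv σ ((σ ^ x) l) (b - x + y) ↔ x ≤ j ∧ j < b + y := by
  rw [hσ.pow_mem_iv l (by omega) (by omega) hj]; omega

theorem pow_mem_backward (hσ : IsCircularOrdering σ) (l : V) {b x y j : ℕ} (hx : x < b)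
    (hy : y < Nat.card V - b) (hj : j < Nat.card V) :
    (σ ^ j) l ∈ iv σ ((σ ^ (Nat.card V - y)) l) (b - x + y) ↔
      j < b - x ∨ Nat.card V - y ≤ j := by
  rw [hσ.pow_mem_iv l (by omega) (by omega) hj]; omega

/-- The two shift amounts are the sizes of the set differences, hence independent of the ordering;
only the direction stays open. -/
theorem eq_forward_or_backward (hσ : IsCircularOrdering σ) {l : V} {b : ℕ} (hb : 0 < b)
    (hb' : b < Nat.card V) {C : Set V} (hC : IsArc σ C) (h : Linked σ (iv σ l b) C) {x y : ℕ}
    (hx : (iv σ l b \ C).ncard = x) (hy : (C \ iv σ l b).ncard = y) :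
    x < b ∧ y < Nat.card V - b ∧
      (C = iv σ ((σ ^ x) l) (b - x + y) ∨
        C = iv σ ((σ ^ (Nat.card V - y)) l) (b - x + y)) := by
  obtain ⟨x', y', hx', hy', hCe⟩ := hσ.exists_shift_of_linked hb hb' hC h
  have hB : ∀ j < Nat.card V, ((σ ^ j) l ∈ iv σ l b ↔ j < b) :=
    fun j hj => hσ.pow_mem_iv_self l hb'.le hj
  suffices hs : x' = x ∧ y' = y by
    obtain ⟨rfl, rfl⟩ := hs
    exact ⟨hx', hy', hCe⟩
  rw [← hx, ← hy]
  rcases hCe with rfl | rfl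
  · constructor
    · rw [hσ.ncard_of_pow_mem_iff l (p := 0) (q := x') (by omega), Nat.sub_zero]
      intro j hj
      rw [Set.mem_sdiff, hB j hj, hσ.pow_mem_forward l hx' hy' hj]; omega
    · rw [hσ.ncard_of_pow_mem_iff l (p := b) (q := b + y') (by omega)]
      · omega
      intro j hj
      rw [Set.mem_sdiff, hB j hj, hσ.pow_mem_forward l hx' hy' hj]; omega
  · constructor
    · rw [hσ.ncard_of_pow_mem_iff l (p := b - x') (q := b) (by omega)]
      · omega
      intro j hj
      rw [Set.mem_sdiff, hB j hj, hσ.pow_mem_backward l hx' hy' hj]; omega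
    · rw [hσ.ncard_of_pow_mem_iff l (p := Nat.card V - y') (q := Nat.card V) (by omega)]
      · omega
      intro j hj
      rw [Set.mem_sdiff, hB j hj, hσ.pow_mem_backward l hx' hy' hj]; omega

theorem subset_of_pow (hσ : IsCircularOrdering σ) (l : V) {S T : Set V}
    (h : ∀ j < Nat.card V, (σ ^ j) l ∈ S → (σ ^ j) l ∈ T) : S ⊆ T := by
  intro w hw
  obtain ⟨j, hj, rfl⟩ := hσ.exists_pow l w
  exact h j hj hw

/-- The forward and the backward shift of `B` cannot both have the same position relative to a
forward shift `A` of `B`. -/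
theorem not_forward_and_backward_of_forward (hσ : IsCircularOrdering σ) {l : V} {b u v x y : ℕ}
    (hb' : b < Nat.card V) (hu : u < b) (hv : v < Nat.card V - b) (hx : x < b)
    (hy : y < Nat.card V - b) {A B C C' : Set V} (hBe : B = iv σ l b)
    (hA : A = iv σ ((σ ^ u) l) (b - u + v))
    (hC : C = iv σ ((σ ^ x) l) (b - x + y))
    (hC' : C' = iv σ ((σ ^ (Nat.card V - y)) l) (b - x + y))
    (huv : u ≠ 0 ∨ v ≠ 0) (hxy : x ≠ 0 ∨ y ≠ 0)
    (hcap : (A ∩ B ∩ C).ncard = (A ∩ B ∩ C').ncard)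
    (hcup : (A ∪ B ∪ C)ᶜ.ncard = (A ∪ B ∪ C')ᶜ.ncard)
    (h1 : A ⊆ C → ShareEndpoint σ A C) (h2 : C ⊆ A → ShareEndpoint σ C A) : False := by
  have mB : ∀ j < Nat.card V, ((σ ^ j) l ∈ B ↔ j < b) := fun j hj => by
    rw [hBe, hσ.pow_mem_iv_self l hb'.le hj]
  have mC : ∀ j < Nat.card V, ((σ ^ j) l ∈ C ↔ x ≤ j ∧ j < b + y) := fun j hj => by
    rw [hC, hσ.pow_mem_forward l hx hy hj]
  have mC' : ∀ j < Nat.card V, ((σ ^ j) l ∈ C' ↔ j < b - x ∨ Nat.card V - y ≤ j) :=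
    fun j hj => by rw [hC', hσ.pow_mem_backward l hx hy hj]
  have mA : ∀ j < Nat.card V, ((σ ^ j) l ∈ A ↔ u ≤ j ∧ j < b + v) := fun j hj => by
    rw [hA, hσ.pow_mem_forward l hu hv hj]
  rw [hσ.ncard_of_pow_mem_iff l (p := max u x) (q := b) (by omega),
    hσ.ncard_of_pow_mem_iff l (p := u) (q := b - x) (by omega)] at hcap
  rotate_left
  · intro j hj
    simp only [Set.mem_inter_iff, mA j hj, mB j hj, mC' j hj]; omega
  · intro j hj
    simp only [Set.mem_inter_iff, mA j hj, mB j hj, mC j hj]; omega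
  rw [hσ.ncard_of_pow_mem_iff l (p := max (b + v) (b + y)) (q := Nat.card V) (by omega),
    hσ.ncard_of_pow_mem_iff l (p := b + v) (q := Nat.card V - y) (by omega)] at hcup
  rotate_left
  · intro j hj
    simp only [Set.mem_compl_iff, Set.mem_union, mA j hj, mB j hj, mC' j hj]; omega
  · intro j hj
    simp only [Set.mem_compl_iff, Set.mem_union, mA j hj, mB j hj, mC j hj]; omega
  -- The positive number `b - max u x` equals the truncated `b - x - u`, so one of `u`, `x`
  -- vanishes; the outer region gives the same for `v`, `y`. One of `A`, `C` then lies inside the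
  -- other with room on both sides, which the endpoint condition forbids.
  have hux : u = 0 ∨ x = 0 := by clear hcup; omega
  have hvy : v = 0 ∨ y = 0 := by clear hcap; omega
  clear hcap hcup
  rcases Nat.eq_zero_or_pos u with h0 | h0
  · have hs := h2 (hσ.subset_of_pow l fun j hj => by rw [mA j hj, mC j hj]; omega)
    rw [hA, hC] at hs
    obtain ⟨i', j', h3, h4, h5⟩ := hσ.shareEndpoint_positions l (by omega) (by omega) (by omega)
      (by omega) (by omega) (by omega) hs
    have hy0 : y = 0 := by omega
    subst h0 hy0
    omega
  · have hs := h1 (hσ.subset_of_pow l fun j hj => by rw [mA j hj, mC j hj]; omega)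
    rw [hA, hC] at hs
    obtain ⟨i', j', h3, h4, h5⟩ := hσ.shareEndpoint_positions l (by omega) (by omega) (by omega)
      (by omega) (by omega) (by omega) hs
    have hx0 : x = 0 := by omega
    have hv0 : v = 0 := by omega
    subst hx0 hv0
    omega

/-- The forward and the backward shift of `B` cannot both have the same position relative to a
backward shift `A` of `B`. -/
theorem not_forward_and_backward_of_backward (hσ : IsCircularOrdering σ) {l : V} {b u v x y : ℕ}
    (hb' : b < Nat.card V) (hu : u < b) (hv : v < Nat.card V - b) (hx : x < b)
    (hy : y < Nat.card V - b) {A B C C' : Set V} (hBe : B = iv σ l b)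
    (hA : A = iv σ ((σ ^ (Nat.card V - v)) l) (b - u + v))
    (hC : C = iv σ ((σ ^ x) l) (b - x + y))
    (hC' : C' = iv σ ((σ ^ (Nat.card V - y)) l) (b - x + y))
    (huv : u ≠ 0 ∨ v ≠ 0) (hxy : x ≠ 0 ∨ y ≠ 0)
    (hcap : (A ∩ B ∩ C).ncard = (A ∩ B ∩ C').ncard)
    (hcup : (A ∪ B ∪ C)ᶜ.ncard = (A ∪ B ∪ C')ᶜ.ncard)
    (h1 : A ⊆ C' → ShareEndpoint σ A C') (h2 : C' ⊆ A → ShareEndpoint σ C' A) : False := by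
  have mB : ∀ j < Nat.card V, ((σ ^ j) l ∈ B ↔ j < b) := fun j hj => by
    rw [hBe, hσ.pow_mem_iv_self l hb'.le hj]
  have mC : ∀ j < Nat.card V, ((σ ^ j) l ∈ C ↔ x ≤ j ∧ j < b + y) := fun j hj => by
    rw [hC, hσ.pow_mem_forward l hx hy hj]
  have mC' : ∀ j < Nat.card V, ((σ ^ j) l ∈ C' ↔ j < b - x ∨ Nat.card V - y ≤ j) :=
    fun j hj => by rw [hC', hσ.pow_mem_backward l hx hy hj]
  have mA : ∀ j < Nat.card V, ((σ ^ j) l ∈ A ↔ j < b - u ∨ Nat.card V - v ≤ j) := fun j hj => by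
    rw [hA, hσ.pow_mem_backward l hu hv hj]
  rw [hσ.ncard_of_pow_mem_iff l (p := x) (q := b - u) (by omega),
    hσ.ncard_of_pow_mem_iff l (p := 0) (q := min (b - u) (b - x)) (by omega)] at hcap
  rotate_left
  · intro j hj
    simp only [Set.mem_inter_iff, mA j hj, mB j hj, mC' j hj]; omega
  · intro j hj
    simp only [Set.mem_inter_iff, mA j hj, mB j hj, mC j hj]; omega
  rw [hσ.ncard_of_pow_mem_iff l (p := b + y) (q := Nat.card V - v) (by omega),
    hσ.ncard_of_pow_mem_iff l (p := b) (q := min (Nat.card V - v) (Nat.card V - y)) (by omega)] at hcup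
  rotate_left
  · intro j hj
    simp only [Set.mem_compl_iff, Set.mem_union, mA j hj, mB j hj, mC' j hj]; omega
  · intro j hj
    simp only [Set.mem_compl_iff, Set.mem_union, mA j hj, mB j hj, mC j hj]; omega
  have hux : u = 0 ∨ x = 0 := by clear hcup; omega
  have hvy : v = 0 ∨ y = 0 := by clear hcap; omega
  clear hcap hcup
  rcases Nat.eq_zero_or_pos u with h0 | h0
  · have hs := h2 (hσ.subset_of_pow l fun j hj => by rw [mA j hj, mC' j hj]; omega)
    rw [hA, hC'] at hs
    obtain ⟨i', j', h3, h4, h5⟩ := hσ.shareEndpoint_positions l (by omega) (by omega) (by omega)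
      (by omega) (by omega) (by omega) hs
    have hy0 : y = 0 := by omega
    subst h0 hy0
    omega
  · have hs := h1 (hσ.subset_of_pow l fun j hj => by rw [mA j hj, mC' j hj]; omega)
    rw [hA, hC'] at hs
    obtain ⟨i', j', h3, h4, h5⟩ := hσ.shareEndpoint_positions l (by omega) (by omega) (by omega)
      (by omega) (by omega) (by omega) hs
    have hx0 : x = 0 := by omega
    have hv0 : v = 0 := by omega
    subst hx0 hv0
    omega

end IsCircularOrdering

end CircArc

/-! ### Isomorphisms and reflections fixing an arc -/

namespace CircArc

variable {V : Type*}

namespace IsCircularOrdering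

variable [Finite V] {σ τ : Perm V}

theorem shift_ne_zero (hσ : IsCircularOrdering σ) {l : V} {b x y : ℕ} {C : Set V}
    (h : C = iv σ ((σ ^ x) l) (b - x + y) ∨ C = iv σ ((σ ^ (Nat.card V - y)) l) (b - x + y))
    (hne : C ≠ iv σ l b) : x ≠ 0 ∨ y ≠ 0 := by
  by_contra! h0
  obtain ⟨rfl, rfl⟩ := h0
  apply hne
  rcases h with rfl | rfl
  · rfl
  · rw [Nat.sub_zero, hσ.pow_card]; rfl

/-- Four sizes locate an arc linked to `B`: the two differences give the shift amounts, and the two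
regions involving `A` give the direction, since `A` is itself a nontrivial shift of `B`. -/
theorem eq_of_linked (hσ : IsCircularOrdering σ) {A B C C' : Set V} (hB : IsArc σ B)
    (hA : IsArc σ A) (hC : IsArc σ C) (hC' : IsArc σ C') (lA : Linked σ B A)
    (lC : Linked σ B C) (lC' : Linked σ B C') (hAB : A ≠ B) (hCB : C ≠ B)
    (n1 : (B \ C').ncard = (B \ C).ncard) (n2 : (C' \ B).ncard = (C \ B).ncard)
    (hcap : (A ∩ B ∩ C').ncard = (A ∩ B ∩ C).ncard)
    (hcup : (A ∪ B ∪ C')ᶜ.ncard = (A ∪ B ∪ C)ᶜ.ncard)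
    (h1 : A ⊆ C → ShareEndpoint σ A C) (h2 : C ⊆ A → ShareEndpoint σ C A)
    (h1' : A ⊆ C' → ShareEndpoint σ A C') (h2' : C' ⊆ A → ShareEndpoint σ C' A) : C' = C := by
  have hBu : B ≠ Set.univ := fun h => lA.union (by rw [h, Set.univ_union])
  obtain ⟨l, b, hb, hb', rfl⟩ := hσ.exists_iv hB (lA.inter.mono Set.inter_subset_left) hBu
  obtain ⟨hu, hv, eA⟩ := hσ.eq_forward_or_backward hb hb' hA lA rfl rfl
  obtain ⟨hx, hy, eC⟩ := hσ.eq_forward_or_backward hb hb' hC lC rfl rfl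
  obtain ⟨-, -, eC'⟩ := hσ.eq_forward_or_backward hb hb' hC' lC' n1 n2
  have huv := hσ.shift_ne_zero eA hAB
  have hxy := hσ.shift_ne_zero eC hCB
  rcases eC with eC | eC <;> rcases eC' with eC' | eC'
  · rw [eC', ← eC]
  · exfalso
    rcases eA with eA | eA
    · exact hσ.not_forward_and_backward_of_forward hb' hu hv hx hy rfl eA eC eC' huv hxy
        hcap.symm hcup.symm h1 h2
    · exact hσ.not_forward_and_backward_of_backward hb' hu hv hx hy rfl eA eC eC' huv hxy
        hcap.symm hcup.symm h1' h2'
  · exfalso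
    rcases eA with eA | eA
    · exact hσ.not_forward_and_backward_of_forward hb' hu hv hx hy rfl eA eC' eC huv hxy
        hcap hcup h1' h2'
    · exact hσ.not_forward_and_backward_of_backward hb' hu hv hx hy rfl eA eC' eC huv hxy
        hcap hcup h1 h2
  · rw [eC', ← eC]

/-- There is an isomorphism of circular orderings with a prescribed value at one point. -/
theorem exists_conj_eq (hσ : IsCircularOrdering σ) (hτ : IsCircularOrdering τ) (a b : V) :
    ∃ g : Perm V, g * σ * g⁻¹ = τ ∧ g a = b := by
  choose idx hidx hidx' using hσ.exists_pow a
  let f : V → V := fun v => (τ ^ idx v) b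
  have hf : ∀ j, f ((σ ^ j) a) = (τ ^ j) b := fun j => by
    rw [hτ.pow_eq_pow_iff, ← hσ.pow_eq_pow_iff a, hidx']
  have hinj : Function.Injective f := by
    intro v w h
    obtain ⟨i, hi, rfl⟩ := hσ.exists_pow a v
    obtain ⟨j, hj, rfl⟩ := hσ.exists_pow a w
    rw [hf, hf] at h
    rw [hτ.pow_inj b hi hj h]
  let g : Perm V := Equiv.ofBijective f (Finite.injective_iff_bijective.1 hinj)
  have hg : ∀ j, g ((σ ^ j) a) = (τ ^ j) b := hf
  refine ⟨g, ?_, hg 0⟩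
  rw [mul_inv_eq_iff_eq_mul]
  ext v
  obtain ⟨j, hj, rfl⟩ := hσ.exists_pow a v
  have h1 : ∀ π : Perm V, ∀ x, π ((π ^ j) x) = (π ^ (j + 1)) x := fun π x => by
    rw [pow_succ', Perm.mul_apply]
  rw [Perm.mul_apply, Perm.mul_apply, hg, h1, h1, hg]

theorem iv_inv (hσ : IsCircularOrdering σ) (a : V) {k : ℕ} (hk : 0 < k)
    (hk' : k ≤ Nat.card V) : iv σ⁻¹ ((σ ^ (k - 1)) a) k = iv σ a k := by
  have h1 : (σ⁻¹ ^ (k - 1)) ((σ ^ (k - 1)) a) = a := by simp [inv_pow]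
  have h2 := hσ.inv.arc_pow ((σ ^ (k - 1)) a) (k := k - 1) (by omega)
  rw [h1, hσ.arc_inv, hσ.arc_pow a (by omega), Nat.sub_add_cancel hk] at h2
  exact h2.symm

/-- The reflection that reverses a given arc exchanges forward and backward shifts. -/
theorem exists_reflection (hσ : IsCircularOrdering σ) (l : V) {b : ℕ} (hb : 0 < b)
    (hb' : b < Nat.card V) : ∃ ρ : Perm V, ρ * σ * ρ⁻¹ = σ⁻¹ ∧ ρ l = (σ ^ (b - 1)) l ∧
      ∀ x y, x < b → y < Nat.card V - b →
      (ρ '' iv σ ((σ ^ x) l) (b - x + y) = iv σ ((σ ^ (Nat.card V - y)) l) (b - x + y) ∧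
      ρ '' iv σ ((σ ^ (Nat.card V - y)) l) (b - x + y) = iv σ ((σ ^ x) l) (b - x + y)) := by
  -- The reflection swaps the first and the last point of the arc.
  obtain ⟨ρ, h, hl⟩ := hσ.exists_conj_eq hσ.inv l ((σ ^ (b - 1)) l)
  refine ⟨ρ, h, hl, fun x y hx hy => ?_⟩
  have hpow : ∀ j, ρ ((σ ^ j) l) = (σ⁻¹ ^ j) ((σ ^ (b - 1)) l) := fun j => by
    rw [← conj_pow_apply, h, hl]
  have key : ∀ i p, (σ ^ i) ((σ ^ p) l) = (σ ^ (i + p)) l := fun i p => by rw [pow_add]; rfl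
  have hk : ∀ p, ρ '' iv σ ((σ ^ p) l) (b - x + y) =
      iv σ⁻¹ ((σ⁻¹ ^ p) ((σ ^ (b - 1)) l)) (b - x + y) := fun p => by
    rw [← iv_conj, h, hpow]
  have hback : ∀ p q, p + q + (b - x + y - 1) ≡ b - 1 [MOD Nat.card V] →
      (σ⁻¹ ^ p) ((σ ^ (b - 1)) l) = (σ ^ (b - x + y - 1)) ((σ ^ q) l) := by
    intro p q hpq
    rw [inv_pow, Perm.inv_eq_iff_eq, key, key, hσ.pow_eq_pow_iff]
    rw [show p + (b - x + y - 1 + q) = p + q + (b - x + y - 1) by ring]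
    exact hpq.symm
  constructor
  · rw [hk, hback x (Nat.card V - y), hσ.iv_inv _ (by omega) (by omega)]
    rw [show x + (Nat.card V - y) + (b - x + y - 1) = b - 1 + Nat.card V by omega]
    simp [Nat.ModEq]
  · rw [hk, hback (Nat.card V - y) x, hσ.iv_inv _ (by omega) (by omega)]
    rw [show Nat.card V - y + x + (b - x + y - 1) = b - 1 + Nat.card V by omega]
    simp [Nat.ModEq]

end IsCircularOrdering

/-! ### Rigidity of tight families -/

/-- A family of nonempty proper arcs such that comparable arcs share an endpoint. -/
structure IsTightFamily {ι : Type*} (S : ι → Set V) (σ : Perm V) : Prop where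
  circ : IsCircularOrdering σ
  isArc : ∀ i, IsArc σ (S i)
  tight : ∀ i j, S i ⊆ S j → ShareEndpoint σ (S i) (S j)

/-- Two members of a family that intersect and do not cover `V`. -/
def Meet {ι : Type*} (S : ι → Set V) (i j : ι) : Prop :=
  (S i ∩ S j).Nonempty ∧ S i ∪ S j ≠ Set.univ

theorem Meet.symm {ι : Type*} {S : ι → Set V} {i j : ι} (h : Meet S i j) : Meet S j i := by
  rwa [Meet, Set.inter_comm, Set.union_comm] at h

variable {ι : Type*} {S : ι → Set V} {σ τ : Perm V}

namespace IsTightFamily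

theorem linked (h : IsTightFamily S σ) {i j : ι} (hij : Meet S i j) :
    Linked σ (S i) (S j) :=
  ⟨hij.1, hij.2, h.tight i j, h.tight j i⟩

theorem image_inv_eq {g : Perm V} {A : Set V} (h : g '' A = A) : ⇑(g⁻¹) '' A = A := by
  conv_lhs => rw [← h]
  rw [← Set.image_comp]
  simp

theorem linked_image (h : IsTightFamily S τ) {i j : ι} (hij : Meet S i j) {g : Perm V}
    (hg : g * σ * g⁻¹ = τ) (hi : ⇑(g⁻¹) '' S i = S i) : Linked σ (S i) (⇑(g⁻¹) '' S j) := by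
  have hσ : g⁻¹ * τ * g⁻¹⁻¹ = σ := by rw [← hg]; group
  refine ⟨?_, ?_, fun hs => ?_, fun hs => ?_⟩
  · rw [← hi, ← Set.image_inter g⁻¹.injective]
    exact hij.1.image _
  · rw [← hi, ← Set.image_union]
    intro hu
    exact hij.2 (Set.image_injective.2 g⁻¹.injective
      (hu.trans (Set.image_univ_of_surjective g⁻¹.surjective).symm))
  · rw [← hi] at hs ⊢
    rw [← hσ]
    exact (h.tight i j (Set.image_subset_image_iff g⁻¹.injective |>.1 hs)).conj g⁻¹
  · rw [← hi] at hs ⊢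
    rw [← hσ]
    exact (h.tight j i (Set.image_subset_image_iff g⁻¹.injective |>.1 hs)).conj g⁻¹

variable [Finite V]

theorem inv (h : IsTightFamily S σ) : IsTightFamily S σ⁻¹ :=
  ⟨h.circ.inv, fun i => h.circ.isArc_inv (h.isArc i),
    fun i j hij => h.circ.shareEndpoint_inv (h.tight i j hij)⟩

/-- An isomorphism preserving two linked members preserves every further member
linked to the first. -/
theorem image_eq_of_meet (hσ : IsTightFamily S σ) (hτ : IsTightFamily S τ) {g : Perm V}
    (hg : g * σ * g⁻¹ = τ) {a b c : ι} (hba : Meet S b a) (hbc : Meet S b c)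
    (hab : S a ≠ S b) (ha : g '' S a = S a) (hb : g '' S b = S b) : g '' S c = S c := by
  by_cases hcb : S c = S b
  · rw [hcb, hb]
  have hσ' : g⁻¹ * τ * g⁻¹⁻¹ = σ := by rw [← hg]; group
  have ha' := image_inv_eq ha
  have hb' := image_inv_eq hb
  have inj := g⁻¹.injective
  have hcard : ∀ X : Set V, (⇑(g⁻¹) '' X).ncard = X.ncard := fun X => Set.ncard_image_of_injective X inj
  have main : ⇑(g⁻¹) '' S c = S c := by
    apply hσ.circ.eq_of_linked (hσ.isArc b) (hσ.isArc a) (hσ.isArc c)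
      (C' := ⇑(g⁻¹) '' S c) (hσ' ▸ (hτ.isArc c).conj g⁻¹) (hσ.linked hba) (hσ.linked hbc)
      (hτ.linked_image hbc hg hb') hab hcb
    · conv_lhs => rw [← hb']
      rw [← Set.image_sdiff inj, hcard]
    · conv_lhs => rw [← hb']
      rw [← Set.image_sdiff inj, hcard]
    · conv_lhs => rw [← hb', ← ha']
      rw [← Set.image_inter inj, ← Set.image_inter inj, hcard]
    · conv_lhs => rw [← hb', ← ha']
      rw [← Set.image_union, ← Set.image_union, ← Set.image_compl_eq g⁻¹.bijective, hcard]
    · exact hσ.tight a c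
    · exact hσ.tight c a
    · intro hs
      rw [← ha'] at hs ⊢
      rw [← hσ']
      exact (hτ.tight a c (Set.image_subset_image_iff inj |>.1 hs)).conj g⁻¹
    · intro hs
      rw [← ha'] at hs ⊢
      rw [← hσ']
      exact (hτ.tight c a (Set.image_subset_image_iff inj |>.1 hs)).conj g⁻¹
  have := image_inv_eq (g := g⁻¹) main
  simpa using this

/-- The set is an arc of the same length in both orderings, so it suffices to send first point to
first point. -/
theorem exists_conj_image_eq (hσ : IsTightFamily S σ) (hτ : IsTightFamily S τ) {i : ι}
    (h0 : (S i).Nonempty) (h1 : S i ≠ Set.univ) :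
    ∃ g : Perm V, g * σ * g⁻¹ = τ ∧ g '' S i = S i := by
  obtain ⟨l, b, hb, hb', e⟩ := hσ.circ.exists_iv (hσ.isArc i) h0 h1
  obtain ⟨l', c, hc, hc', e'⟩ := hτ.circ.exists_iv (hτ.isArc i) h0 h1
  have hbc : b = c := by
    have c1 : (S i).ncard = b := by
      rw [hσ.circ.ncard_of_pow_mem_iff l (p := 0) (q := b) hb'.le, Nat.sub_zero]
      intro j hj
      rw [e, hσ.circ.pow_mem_iv_self l hb'.le hj]; omega
    have c2 : (S i).ncard = c := by
      rw [hτ.circ.ncard_of_pow_mem_iff l' (p := 0) (q := c) hc'.le, Nat.sub_zero]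
      intro j hj
      rw [e', hτ.circ.pow_mem_iv_self l' hc'.le hj]; omega
    omega
  subst hbc
  obtain ⟨g, hg, hl⟩ := hσ.circ.exists_conj_eq hτ.circ l l'
  refine ⟨g, hg, ?_⟩
  conv_lhs => rw [e]
  rw [← iv_conj, hg, hl, ← e']

/-- After matching `S i`, the pullback of `S j` is the right shift of `S i` up to direction. If the
direction is wrong, the reflection of `S i` corrects it at the cost of replacing `τ` by its
reversal. -/
theorem exists_conj_image_eq_of_meet (hσ : IsTightFamily S σ) (hτ : IsTightFamily S τ)
    {i j : ι} (hij : Meet S i j) :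
    ∃ g : Perm V, (g * σ * g⁻¹ = τ ∨ g * σ * g⁻¹ = τ⁻¹) ∧ g '' S i = S i ∧ g '' S j = S j := by
  have h0 : (S i).Nonempty := hij.1.mono Set.inter_subset_left
  have h1 : S i ≠ Set.univ := fun h => hij.2 (by rw [h, Set.univ_union])
  obtain ⟨g, hg, hi⟩ := hσ.exists_conj_image_eq hτ h0 h1
  have hσ' : g⁻¹ * τ * g⁻¹⁻¹ = σ := by rw [← hg]; group
  have hi' := image_inv_eq hi
  have inj := g⁻¹.injective
  have hcard : ∀ X : Set V, (⇑(g⁻¹) '' X).ncard = X.ncard := fun X => Set.ncard_image_of_injective X inj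
  have l1 := hσ.linked hij
  have l2 := hτ.linked_image hij hg hi'
  have a2 : IsArc σ (⇑(g⁻¹) '' S j) := hσ' ▸ (hτ.isArc j).conj g⁻¹
  have n1 : (S i \ ⇑(g⁻¹) '' S j).ncard = (S i \ S j).ncard := by
    conv_lhs => rw [← hi']
    rw [← Set.image_sdiff inj, hcard]
  have n2 : (⇑(g⁻¹) '' S j \ S i).ncard = (S j \ S i).ncard := by
    conv_lhs => rw [← hi']
    rw [← Set.image_sdiff inj, hcard]
  obtain ⟨l, b, hb, hb', e⟩ := hσ.circ.exists_iv (hσ.isArc i) h0 h1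
  rw [e] at l1 l2
  obtain ⟨hx, hy, e1⟩ := hσ.circ.eq_forward_or_backward hb hb' (hσ.isArc j) l1 rfl rfl
  obtain ⟨-, -, e2⟩ := hσ.circ.eq_forward_or_backward hb hb' a2 l2 (e ▸ n1) (e ▸ n2)
  have back : g '' (⇑(g⁻¹) '' S j) = S j := by rw [← Set.image_comp]; simp
  by_cases heq : ⇑(g⁻¹) '' S j = S j
  · exact ⟨g, Or.inl hg, hi, by rw [← heq, back, heq]⟩
  obtain ⟨ρ, hρ, -, hs⟩ := hσ.circ.exists_reflection l hb hb'
  have hρi : ρ '' S i = S i := by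
    have := (hs 0 0 hb (by omega)).1
    rw [Nat.sub_zero (Nat.card V), hσ.circ.pow_card] at this
    rw [e]; exact this
  have hρj : ρ '' S j = ⇑(g⁻¹) '' S j := by
    rcases e1 with e1 | e1 <;> rcases e2 with e2 | e2
    · exact absurd (e2.trans e1.symm) heq
    · rw [e2, ← (hs _ _ hx hy).1, ← e1]
    · rw [e2, ← (hs _ _ hx hy).2, ← e1]
    · exact absurd (e2.trans e1.symm) heq
  refine ⟨g * ρ, Or.inr ?_, ?_, ?_⟩
  · calc g * ρ * σ * (g * ρ)⁻¹ = g * (ρ * σ * ρ⁻¹) * g⁻¹ := by group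
      _ = (g * σ * g⁻¹)⁻¹ := by rw [hρ]; group
      _ = τ⁻¹ := by rw [hg]
  · rw [Perm.coe_mul, Set.image_comp, hρi, hi]
  · rw [Perm.coe_mul, Set.image_comp, hρj, back]

/-- Uniqueness up to reversal of tight arc orderings, for a connected component of a family:
any two are related by an isomorphism preserving all members of the component. -/
theorem exists_conj_forall_image_eq (hσ : IsTightFamily S σ) (hτ : IsTightFamily S τ) {i₀ : ι}
    (h0 : (S i₀).Nonempty) (h1 : S i₀ ≠ Set.univ) :
    ∃ g : Perm V, (g * σ * g⁻¹ = τ ∨ g * σ * g⁻¹ = τ⁻¹) ∧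
      ∀ i, Relation.ReflTransGen (Meet S) i₀ i → g '' S i = S i := by
  by_cases hall : ∃ j, Meet S i₀ j ∧ S j ≠ S i₀
  · obtain ⟨j, hj, hne⟩ := hall
    obtain ⟨g, hg, g0, gj⟩ := hσ.exists_conj_image_eq_of_meet hτ hj
    refine ⟨g, hg, ?_⟩
    have hstep : ∀ {a b c : ι}, Meet S b a → Meet S b c → S a ≠ S b → g '' S a = S a →
        g '' S b = S b → g '' S c = S c := by
      rcases hg with hg | hg
      · exact fun h1 h2 h3 h4 h5 => hσ.image_eq_of_meet hτ hg h1 h2 h3 h4 h5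
      · exact fun h1 h2 h3 h4 h5 => hσ.image_eq_of_meet hτ.inv hg h1 h2 h3 h4 h5
    intro i hi
    -- The next member is placed relative to a pair of distinct preserved members, so the induction
    -- carries such a partner `k` along.
    suffices h : g '' S i = S i ∧ ∃ k, Meet S i k ∧ S k ≠ S i ∧ g '' S k = S k from h.1
    induction hi with
    | refl => exact ⟨g0, j, hj, hne, gj⟩
    | @tail b c _ hbc ih =>
      obtain ⟨gb, k, hk, hkne, gk⟩ := ih
      have gc := hstep hk hbc hkne gk gb
      refine ⟨gc, ?_⟩
      by_cases hcb : S c = S b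
      · refine ⟨k, ?_, by rwa [hcb], gk⟩
        rwa [Meet, hcb]
      · exact ⟨b, hbc.symm, Ne.symm hcb, gb⟩
  -- No distinct partner exists, so all members of the component are the same set and matching that
  -- one set is enough.
  · push Not at hall
    obtain ⟨g, hg, g0⟩ := hσ.exists_conj_image_eq hτ h0 h1
    refine ⟨g, Or.inl hg, fun i hi => ?_⟩
    suffices h : S i = S i₀ by rw [h, g0]
    induction hi with
    | refl => rfl
    | tail _ hbc ih => exact hall _ (by rwa [Meet, ih] at hbc)

end IsTightFamily

end CircArc

/-! ### Round orderings -/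

namespace CircArc

variable {V : Type*}

/-- A round ordering of a graph: `R u v` says that the forward reach of `u` along the circular
ordering contains `v`; the adjacency relation is the symmetrization of `R`. -/
structure IsRound (G : SimpleGraph V) (σ : Perm V) (R : V → V → Prop) : Prop where
  circ : IsCircularOrdering σ
  refl : ∀ v, R v v
  mono : ∀ v i l j, i ≤ l → l ≤ j → j < Nat.card V → R v ((σ ^ j) v) →
    R ((σ ^ i) v) ((σ ^ l) v)
  adj : ∀ u v, G.Adj u v ↔ u ≠ v ∧ (R u v ∨ R v u)

variable {G : SimpleGraph V}

theorem mem_closedNbhd {u v : V} : u ∈ closedNbhd G v ↔ u = v ∨ G.Adj v u := Iff.rfl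

theorem mem_closedNbhd_comm {u v : V} : u ∈ closedNbhd G v ↔ v ∈ closedNbhd G u := by
  rw [mem_closedNbhd, mem_closedNbhd, eq_comm, G.adj_comm]

theorem self_mem_closedNbhd (v : V) : v ∈ closedNbhd G v := Or.inl rfl

theorem notMem_closedNbhd {u v : V} : u ∉ closedNbhd G v ↔ Gᶜ.Adj v u := by
  rw [mem_closedNbhd, SimpleGraph.compl_adj]
  tauto

/-- The complement of a union of two cliques is bipartite. -/
theorem isBipartite_compl_of_cliques {K L : Set V} (hK : G.IsClique K) (hL : G.IsClique L)
    (h : K ∪ L = Set.univ) : Gᶜ.IsBipartite := by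
  classical
  refine ⟨SimpleGraph.Coloring.mk (fun v => if v ∈ K then 0 else 1) fun {u v} huv => ?_⟩
  rw [SimpleGraph.compl_adj] at huv
  by_cases hu : u ∈ K <;> by_cases hv : v ∈ K <;> simp only [hu, hv, if_true, if_false]
  · exact absurd (hK hu hv huv.1) huv.2
  · simp
  · simp
  · have hu' : u ∈ L := (h ▸ Set.mem_univ u : u ∈ K ∪ L).resolve_left hu
    have hv' : v ∈ L := (h ▸ Set.mem_univ v : v ∈ K ∪ L).resolve_left hv
    exact absurd (hL hu' hv' huv.1) huv.2

namespace IsRound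

variable {σ : Perm V} {R : V → V → Prop}

theorem inv (h : IsRound G σ R) : IsRound G σ⁻¹ (fun u v => R v u) := by
  refine ⟨h.circ.inv, h.refl, fun v i l j hil hlj hj hR => ?_, fun u v => ?_⟩
  · obtain ⟨w, rfl⟩ := (σ ^ j).surjective v
    have key : ∀ t ≤ j, (σ⁻¹ ^ t) ((σ ^ j) w) = (σ ^ (j - t)) w := by
      intro t ht
      rw [inv_pow, Perm.inv_eq_iff_eq, ← Perm.mul_apply, ← pow_add, Nat.add_sub_cancel' ht]
    rw [key j le_rfl, Nat.sub_self] at hR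
    rw [key i (by omega), key l hlj]
    exact h.mono w (j - l) (j - i) j (by omega) (by omega) hj hR
  · rw [h.adj, or_comm]

theorem mem_closedNbhd_iff (h : IsRound G σ R) {u v : V} :
    u ∈ closedNbhd G v ↔ R v u ∨ R u v := by
  rw [mem_closedNbhd, h.adj]
  by_cases huv : u = v
  · subst huv; simp [h.refl]
  · simp [huv, Ne.symm huv]

variable [Finite V]

theorem exists_reach (h : IsRound G σ R) (v : V) :
    ∃ F < Nat.card V, ∀ j < Nat.card V, (R v ((σ ^ j) v) ↔ j ≤ F) := by
  classical
  have hn : 0 < Nat.card V := Nat.card_pos_iff.2 ⟨⟨v⟩, inferInstance⟩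
  refine ⟨Nat.findGreatest (fun j => R v ((σ ^ j) v)) (Nat.card V - 1), ?_, fun j hj => ⟨?_, ?_⟩⟩
  · exact (Nat.findGreatest_le _).trans_lt (by omega)
  · exact fun hR => Nat.le_findGreatest (P := fun j => R v ((σ ^ j) v)) (by omega) hR
  · intro hle
    have hs := Nat.findGreatest_spec (P := fun j => R v ((σ ^ j) v)) (Nat.zero_le (Nat.card V - 1))
      (h.refl v)
    exact h.mono v 0 j _ (by omega) hle ((Nat.findGreatest_le _).trans_lt (by omega)) hs

/-- `F` and `B` are the forward and backward reach of `v`. They may overlap on the far side of the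
circle, in which case the neighborhood is all of `V`. -/
theorem exists_closedNbhd (h : IsRound G σ R) (v : V) :
    ∃ F B, F < Nat.card V ∧ B < Nat.card V ∧ (∀ j < Nat.card V, (R v ((σ ^ j) v) ↔ j ≤ F)) ∧
      (∀ j < Nat.card V, ((σ ^ j) v ∈ closedNbhd G v ↔ j ≤ F ∨ Nat.card V ≤ j + B)) ∧
      closedNbhd G v = iv σ ((σ ^ (Nat.card V - B)) v) (B + F + 1) := by
  obtain ⟨F, hF, hF'⟩ := h.exists_reach v
  obtain ⟨B, hB, hB'⟩ := h.inv.exists_reach v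
  have hmem : ∀ j < Nat.card V, ((σ ^ j) v ∈ closedNbhd G v ↔ j ≤ F ∨ Nat.card V ≤ j + B) := by
    intro j hj
    rw [h.mem_closedNbhd_iff, hF' j hj]
    rcases Nat.eq_zero_or_pos j with rfl | hj0
    · simp
    · have := hB' (Nat.card V - j) (by omega)
      rw [h.circ.inv_pow_apply v (by omega), Nat.sub_sub_self hj.le] at this
      rw [this]; omega
  refine ⟨F, B, hF, hB, hF', hmem, ?_⟩
  rcases Nat.lt_or_ge (Nat.card V) (B + F + 1) with hc | hc
  · rw [h.circ.iv_of_le _ hc.le]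
    refine h.circ.set_ext v fun j hj => ?_
    rw [hmem j hj]
    simp only [Set.mem_univ, iff_true]
    omega
  · refine h.circ.set_ext v fun j hj => ?_
    rw [hmem j hj, h.circ.pow_mem_iv v (by omega) hc hj]
    omega

theorem isArc_closedNbhd (h : IsRound G σ R) (v : V) : IsArc σ (closedNbhd G v) := by
  obtain ⟨F, B, -, -, -, -, e⟩ := h.exists_closedNbhd v
  rw [e]
  exact h.circ.isArc_iv _ _

/-- If `v` reaches `u`, monotonicity says that `u` reaches at least as far as `v`; the inclusion
forbids reaching farther. The two arcs therefore have the same last point. -/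
theorem shareEndpoint_of_reach (h : IsRound G σ R) {u v : V}
    (huv : closedNbhd G u ⊆ closedNbhd G v) (hv : closedNbhd G v ≠ Set.univ) (hR : R v u) :
    ShareEndpoint σ (closedNbhd G u) (closedNbhd G v) := by
  have hu : closedNbhd G u ≠ Set.univ := fun hu => hv (Set.univ_subset_iff.1 (hu ▸ huv))
  obtain ⟨j, hj, rfl⟩ := h.circ.exists_pow v u
  obtain ⟨F, B, hF, hB, hF1, hm1, e1⟩ := h.exists_closedNbhd v
  obtain ⟨F', B', hF', hB', hF2, hm2, e2⟩ := h.exists_closedNbhd ((σ ^ j) v)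
  have key : ∀ i w, (σ ^ i) ((σ ^ w) v) = (σ ^ (i + w)) v := fun i p => by rw [pow_add]; rfl
  have c1 : B + F + 1 < Nat.card V := by
    by_contra! hc
    exact hv (e1.trans (h.circ.iv_of_le _ hc))
  have c2 : B' + F' + 1 < Nat.card V := by
    by_contra! hc
    exact hu (e2.trans (h.circ.iv_of_le _ hc))
  have hjF := (hF1 j hj).1 hR
  have hle : F - j ≤ F' := by
    rw [← hF2 _ (by omega), key, Nat.sub_add_cancel hjF]
    exact h.mono v j F F hjF le_rfl hF ((hF1 F hF).2 le_rfl)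
  have hge : F' ≤ F - j := by
    by_contra! hlt
    have h1 : (σ ^ (F - j + 1)) ((σ ^ j) v) ∈ closedNbhd G v :=
      huv ((hm2 _ (by omega)).2 (Or.inl (by omega)))
    rw [key, show F - j + 1 + j = F + 1 by omega, hm1 _ (by omega)] at h1
    omega
  rw [e1, e2, h.circ.shareEndpoint_iv_iff (by omega) c2 (by omega) c1]
  refine Or.inr (Or.inr (Or.inr ?_))
  rw [key, key, key, h.circ.pow_eq_pow_iff]
  rw [show B' + F' + 1 - 1 + (Nat.card V - B' + j) = F + Nat.card V by omega,
    show B + F + 1 - 1 + (Nat.card V - B) = F + Nat.card V by omega]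

theorem shareEndpoint (h : IsRound G σ R) {u v : V}
    (huv : closedNbhd G u ⊆ closedNbhd G v) (hv : closedNbhd G v ≠ Set.univ) :
    ShareEndpoint σ (closedNbhd G u) (closedNbhd G v) := by
  rcases h.mem_closedNbhd_iff.1 (huv (self_mem_closedNbhd u)) with hR | hR
  · exact h.shareEndpoint_of_reach huv hv hR
  · have := h.circ.inv.shareEndpoint_inv (h.inv.shareEndpoint_of_reach huv hv hR)
    rwa [inv_inv] at this

theorem isTightArcOrdering (h : IsRound G σ R) :
    IsTightArcOrdering (closedNbhdHypergraph G) σ := by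
  refine ⟨⟨h.circ, ?_⟩, ?_⟩
  · rintro _ ⟨v, rfl⟩
    exact h.isArc_closedNbhd v
  · rintro _ ⟨u, rfl⟩ _ ⟨v, rfl⟩ - huv hv
    exact h.shareEndpoint huv hv

/-- Of two vertices reached from `v`, the earlier one reaches the later one by monotonicity. -/
theorem isClique_reach (h : IsRound G σ R) (v : V) : G.IsClique {w | R v w} := by
  have key : ∀ i j, i ≤ j → j < Nat.card V → R v ((σ ^ j) v) → R ((σ ^ i) v) ((σ ^ j) v) :=
    fun i j hij hj hR => h.mono v i j j hij le_rfl hj hR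
  intro a ha b hb hab
  obtain ⟨i, hi, rfl⟩ := h.circ.exists_pow v a
  obtain ⟨j, hj, rfl⟩ := h.circ.exists_pow v b
  rw [h.adj]
  refine ⟨hab, ?_⟩
  rcases le_total i j with hij | hij
  · exact Or.inl (key i j hij hj hb)
  · exact Or.inr (key j i hij hi ha)

theorem isClique_reach' (h : IsRound G σ R) (v : V) : G.IsClique {w | R w v} :=
  h.inv.isClique_reach v

/-- Every closed neighborhood is covered by two cliques. -/
theorem exists_cliques (h : IsRound G σ R) (v : V) :
    ∃ K L : Set V, G.IsClique K ∧ G.IsClique L ∧ closedNbhd G v = K ∪ L :=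
  ⟨_, _, h.isClique_reach v, h.isClique_reach' v, by ext u; exact h.mem_closedNbhd_iff⟩

/-- What `v` reaches beyond itself is also reached by `σ v`, and what reaches `σ v` from before also
reaches `v`. A covering would thus split `V` into two cliques: the vertices reaching `v` and those
reached from `σ v`. -/
theorem closedNbhd_union_ne_univ (h : IsRound G σ R) (hb : ¬ Gᶜ.IsBipartite) (v : V) :
    closedNbhd G v ∪ closedNbhd G (σ v) ≠ Set.univ := by
  intro hu
  refine hb (isBipartite_compl_of_cliques (h.isClique_reach' v) (h.isClique_reach (σ v)) ?_)
  rw [Set.eq_univ_iff_forall]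
  intro w
  have hw : w ∈ closedNbhd G v ∪ closedNbhd G (σ v) := hu ▸ Set.mem_univ w
  rw [Set.mem_union, h.mem_closedNbhd_iff, h.mem_closedNbhd_iff] at hw
  change R w v ∨ R (σ v) w
  rcases hw with (hw | hw) | (hw | hw)
  · obtain ⟨j, hj, rfl⟩ := h.circ.exists_pow v w
    rcases Nat.eq_zero_or_pos j with rfl | hj0
    · exact Or.inl hw
    · exact Or.inr (h.mono v 1 j j hj0 le_rfl hj hw)
  · exact Or.inl hw
  · exact Or.inr hw
  · obtain ⟨j, hj, hjw⟩ := h.circ.exists_pow w (σ v)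
    rcases Nat.eq_zero_or_pos j with rfl | hj0
    · rw [pow_zero, Perm.coe_one, id] at hjw
      exact Or.inr (hjw ▸ h.refl w)
    · left
      obtain ⟨i, rfl⟩ : ∃ i, j = i + 1 := ⟨j - 1, by omega⟩
      rw [← hjw] at hw
      have hv : (σ ^ i) w = v := by
        apply σ.injective
        rw [← hjw, pow_succ', Perm.mul_apply]
      have := h.mono w 0 i (i + 1) (Nat.zero_le _) (by omega) hj hw
      rwa [hv] at this

/-- An edge is replaced by the run of consecutive vertices it spans. Consecutive vertices in the run
are related by `R`, so their neighborhoods intersect, and they do not cover `V`. -/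
theorem reflTransGen_meet (h : IsRound G σ R) (hb : ¬ Gᶜ.IsBipartite) (hG : G.Connected)
    (u v : V) : Relation.ReflTransGen (Meet (closedNbhd G)) u v := by
  have hreach : ∀ a b, R a b → Relation.ReflTransGen (Meet (closedNbhd G)) a b := by
    intro a b hab
    obtain ⟨j, hj, rfl⟩ := h.circ.exists_pow a b
    have : ∀ i ≤ j, Relation.ReflTransGen (Meet (closedNbhd G)) a ((σ ^ i) a) := by
      intro i
      induction i with
      | zero => exact fun _ => Relation.ReflTransGen.refl
      | succ i ih =>
        intro hi
        refine (ih (by omega)).tail ?_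
        have h1 := h.mono a i (i + 1) j (by omega) hi hj hab
        rw [pow_succ', Perm.mul_apply] at h1 ⊢
        exact ⟨⟨_, self_mem_closedNbhd _, h.mem_closedNbhd_iff.2 (Or.inr h1)⟩,
          h.closedNbhd_union_ne_univ hb _⟩
    exact this j le_rfl
  have hsymm : ∀ a b, Relation.ReflTransGen (Meet (closedNbhd G)) a b →
      Relation.ReflTransGen (Meet (closedNbhd G)) b a := fun a b hab =>
    have : Std.Symm (Meet (closedNbhd G)) := ⟨fun _ _ => Meet.symm⟩
    Std.Symm.symm a b hab
  have hadj : ∀ a b, G.Adj a b → Relation.ReflTransGen (Meet (closedNbhd G)) a b := by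
    intro a b hab
    rcases ((h.adj a b).1 hab).2 with hR | hR
    · exact hreach a b hR
    · exact hsymm _ _ (hreach b a hR)
  obtain ⟨p⟩ := hG.preconnected u v
  induction p with
  | nil => exact Relation.ReflTransGen.refl
  | cons hab _ ih => exact (hadj _ _ hab).trans ih

end IsRound

/-! ### From proper arc representations to round orderings -/

theorem isCircularOrdering_finRotate (m : ℕ) : IsCircularOrdering (finRotate m) := by
  rcases Nat.lt_or_ge m 2 with hm | hm
  · have : Subsingleton (Fin m) := Fin.subsingleton_iff_le_one.2 (by omega)
    exact Perm.isCycleOn_of_subsingleton _ _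
  · have h := (isCycle_finRotate_of_le hm).isCycleOn
    have hs : {x | finRotate m x ≠ x} = Set.univ := by
      have := support_finRotate_of_le hm
      ext x
      simp only [Set.mem_univ, iff_true]
      exact Perm.mem_support.1 (this ▸ Finset.mem_univ x)
    rwa [hs] at h

theorem finRotate_pow_val {n : ℕ} (i : Fin n) (j : ℕ) :
    (((finRotate n) ^ j) i : ℕ) = (i + j) % n := by
  induction j with
  | zero => simp [Nat.mod_eq_of_lt i.2]
  | succ j ih =>
    have := i.neZero
    rw [pow_succ', Perm.mul_apply, finRotate_apply, Fin.val_add, ih]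
    simp [← add_assoc]

/-- Cyclic distance from `a` to `b` on a circle of length `m`. -/
def cdist (m a b : ℕ) : ℕ := if a ≤ b then b - a else m + b - a

section Representation

variable {X : Type*} [Finite X] {ρ : Perm X}

/-- Read going forward from `p`, an arc not contained in the first one must end after it. -/
theorem cdist_of_not_subset (hρ : IsCircularOrdering ρ) (l : X) {p q k k' : ℕ}
    (hp : p < Nat.card X) (hq : q < Nat.card X) (hk : k < Nat.card X) (hk' : k' < Nat.card X)
    (h : ¬ iv ρ ((ρ ^ q) l) k' ⊆ iv ρ ((ρ ^ p) l) k) : k < cdist (Nat.card X) p q + k' := by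
  by_contra! hc
  refine h (hρ.subset_of_pow l fun j hj => ?_)
  rw [hρ.pow_mem_iv l hp.le hk.le hj, hρ.pow_mem_iv l hq.le hk'.le hj]
  rw [cdist] at hc
  split_ifs at hc <;> omega

theorem inter_nonempty_iff_cdist (hρ : IsCircularOrdering ρ) (l : X) {p q k k' : ℕ}
    (hp : p < Nat.card X) (hq : q < Nat.card X) (hk : k < Nat.card X) (hk' : k' < Nat.card X)
    (hk0 : 0 < k) (hk0' : 0 < k') :
    (iv ρ ((ρ ^ p) l) k ∩ iv ρ ((ρ ^ q) l) k').Nonempty ↔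
      cdist (Nat.card X) p q < k ∨ cdist (Nat.card X) q p < k' := by
  constructor
  · rintro ⟨v, h1, h2⟩
    obtain ⟨j, hj, rfl⟩ := hρ.exists_pow l v
    rw [hρ.pow_mem_iv l hp.le hk.le hj] at h1
    rw [hρ.pow_mem_iv l hq.le hk'.le hj] at h2
    rw [cdist, cdist]
    split_ifs <;> omega
  · rintro (h | h)
    · refine ⟨(ρ ^ q) l, ?_, ?_⟩
      · rw [hρ.pow_mem_iv l hp.le hk.le hq]
        rw [cdist] at h
        split_ifs at h <;> omega
      · rw [hρ.pow_mem_iv l hq.le hk'.le hq]; omega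
    · refine ⟨(ρ ^ p) l, ?_, ?_⟩
      · rw [hρ.pow_mem_iv l hp.le hk.le hp]; omega
      · rw [hρ.pow_mem_iv l hq.le hk'.le hp]
        rw [cdist] at h
        split_ifs at h <;> omega

end Representation

/-- Sorting the vertices by the start points of their arcs gives a round ordering. -/
theorem exists_isRound_of_starts [Finite V] {m : ℕ} {S k : V → ℕ} (hS : ∀ v, S v < m)
    (hk : ∀ v, 0 < k v) (hsub : ∀ u v, u ≠ v → k u < cdist m (S u) (S v) + k v)
    (hadj : ∀ u v, u ≠ v → (G.Adj u v ↔ cdist m (S u) (S v) < k u ∨ cdist m (S v) (S u) < k v)) :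
    ∃ σ R, IsRound G σ R := by
  -- Of two arcs with the same start, one would contain the other.
  have hinj : Function.Injective S := by
    intro u v huv
    by_contra hne
    have h1 := hsub u v hne
    have h2 := hsub v u (Ne.symm hne)
    simp only [cdist, huv, le_refl, if_true, Nat.sub_self] at h1 h2
    omega
  obtain ⟨e, he⟩ : ∃ e : V ≃ Fin (Nat.card V), ∀ u v, e u < e v ↔ S u < S v := by
    let _ : LinearOrder V := LinearOrder.lift' S hinj
    cases nonempty_fintype V
    let f := Fintype.orderIsoFinOfCardEq V (Nat.card_eq_fintype_card (α := V)).symm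
    exact ⟨f.symm.toEquiv, fun u v => f.symm.lt_iff_lt⟩
  let σ : Perm V := e.permCongr.symm (finRotate (Nat.card V))
  have hpow : ∀ j v, e ((σ ^ j) v) = (finRotate (Nat.card V) ^ j) (e v) := by
    intro j v
    induction j with
    | zero => rfl
    | succ j ih =>
      rw [pow_succ', pow_succ', Perm.mul_apply, Perm.mul_apply, ← ih]
      simp [σ]
  have hval : ∀ j v, (e ((σ ^ j) v) : ℕ) = (e v + j) % Nat.card V := fun j v => by
    rw [hpow, finRotate_pow_val]
  -- Within one turn of `σ` the start points also go round at most once, so cyclic distances add up.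
  have hadd : ∀ v i l, i ≤ l → l < Nat.card V →
      cdist m (S v) (S ((σ ^ i) v)) + cdist m (S ((σ ^ i) v)) (S ((σ ^ l) v)) =
        cdist m (S v) (S ((σ ^ l) v)) := by
    intro v i l hil hl
    have hi := hval i v
    have hl' := hval l v
    have hv := (e v).2
    have le_iff : ∀ a b : V, S a ≤ S b ↔ (e a : ℕ) ≤ e b := fun a b => by
      rw [← not_lt, ← he, Fin.lt_def, not_lt]
    have b1 := hS v
    have b2 := hS ((σ ^ i) v)
    have b3 := hS ((σ ^ l) v)
    have hmod : ∀ j < Nat.card V, ((e v : ℕ) + j < Nat.card V ∧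
        ((e v : ℕ) + j) % Nat.card V = e v + j) ∨ (Nat.card V ≤ (e v : ℕ) + j ∧
        ((e v : ℕ) + j) % Nat.card V = e v + j - Nat.card V) := by
      intro j hj
      rcases Nat.lt_or_ge ((e v : ℕ) + j) (Nat.card V) with h | h
      · exact Or.inl ⟨h, Nat.mod_eq_of_lt h⟩
      · exact Or.inr ⟨h, by rw [Nat.mod_eq_sub_mod h, Nat.mod_eq_of_lt (by omega)]⟩
    have m1 := hmod i (by omega)
    have m2 := hmod l hl
    rw [← hi] at m1
    rw [← hl'] at m2
    have c1 := le_iff v ((σ ^ i) v)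
    have c2 := le_iff v ((σ ^ l) v)
    have c3 := le_iff ((σ ^ i) v) ((σ ^ l) v)
    have c4 := le_iff ((σ ^ i) v) v
    have c5 := le_iff ((σ ^ l) v) ((σ ^ i) v)
    generalize S v = s0 at *
    generalize S ((σ ^ i) v) = s1 at *
    generalize S ((σ ^ l) v) = s2 at *
    rw [cdist, cdist, cdist]
    split_ifs <;> omega
  -- The relation says that the arc of `u` contains the start point of the arc of `v`.
  refine ⟨σ, fun u v => cdist m (S u) (S v) < k u, ⟨⟨?_, ?_, ?_⟩, ?_⟩, fun v => ?_, ?_, ?_⟩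
  · exact fun _ _ => Set.mem_univ _
  · exact σ.injective.injOn
  · exact fun v _ => ⟨σ⁻¹ v, Set.mem_univ _, by simp⟩
  · intro u _ v _
    refine ⟨((Nat.card V + e v - e u : ℕ) : ℤ), ?_⟩
    rw [zpow_natCast]
    apply e.injective
    ext
    rw [hval, Nat.add_sub_cancel' (by omega), Nat.add_mod_left, Nat.mod_eq_of_lt (e v).2]
  · simpa [cdist] using hk v
  · intro v i l j hil hlj hj hR
    have h1 := hadd v i l hil (by omega)
    have h2 := hadd v l j hlj hj
    by_cases hw : (σ ^ i) v = v
    · rw [hw]; omega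
    -- The arc of a vertex other than `v` ends later than that of `v`, so it still covers the start
    -- points between its own start and the end of the arc of `v`.
    · have h3 := hsub v ((σ ^ i) v) (Ne.symm hw)
      omega
  · intro u v
    by_cases huv : u = v
    · subst huv; simp
    · simp [huv, hadj u v huv]

theorem IsPCA.exists_isRound [Finite V] [Nontrivial V] (h : IsPCA G) :
    ∃ σ R, IsRound G σ R := by
  obtain ⟨m, α, -, harc, hadj, hsub⟩ := h
  have hρ := isCircularOrdering_finRotate m
  -- A second vertex rules out empty and full arcs, since either would create a containment.
  have h0 : ∀ v, (α v).Nonempty := fun v => by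
    obtain ⟨w, hw⟩ := exists_ne v
    rw [Set.nonempty_iff_ne_empty]
    intro he
    exact hsub v w hw.symm (he ▸ Set.empty_subset _)
  have h1 : ∀ v, α v ≠ Set.univ := fun v hv => by
    obtain ⟨w, hw⟩ := exists_ne v
    exact hsub w v hw (hv ▸ Set.subset_univ _)
  obtain ⟨v₀, -⟩ := exists_pair_ne V
  obtain ⟨l, -⟩ := h0 v₀
  have hiv : ∀ v, ∃ p k, p < Nat.card (Fin m) ∧ 0 < k ∧ k < Nat.card (Fin m) ∧
      α v = iv (finRotate m) ((finRotate m ^ p) l) k := fun v => by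
    obtain ⟨a, k, hk, hk', e⟩ := hρ.exists_iv (harc v) (h0 v) (h1 v)
    obtain ⟨p, hp, rfl⟩ := hρ.exists_pow l a
    exact ⟨p, k, hp, hk, hk', e⟩
  choose S k hS hk hk' hα using hiv
  refine exists_isRound_of_starts (G := G) hS hk (fun u v huv => ?_) fun u v huv => ?_
  · refine cdist_of_not_subset hρ l (hS u) (hS v) (hk' u) (hk' v) ?_
    rw [← hα, ← hα]
    exact hsub v u huv.symm
  · rw [hadj u v huv, hα u, hα v,
      inter_nonempty_iff_cdist hρ l (hS u) (hS v) (hk' u) (hk' v) (hk u) (hk v)]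

end CircArc

/-! ### Non-bipartite complement: tightness and uniqueness -/

namespace CircArc

variable {V : Type*} {G : SimpleGraph V} {σ τ : Perm V}

theorem isTightFamily_closedNbhd (h : IsTightArcOrdering (closedNbhdHypergraph G) σ)
    (hu : ∀ v, closedNbhd G v ≠ Set.univ) : IsTightFamily (closedNbhd G) σ :=
  ⟨h.1.1, fun v => h.1.2 _ ⟨v, rfl⟩, fun u v huv =>
    h.2 _ ⟨u, rfl⟩ _ ⟨v, rfl⟩ ⟨u, self_mem_closedNbhd u⟩ huv (hu v)⟩

theorem mem_iff_of_image_eq {g : Perm V} {A : Set V} (h : g '' A = A) (v : V) :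
    g v ∈ A ↔ v ∈ A := by
  conv_lhs => rw [← h]
  exact g.injective.mem_set_image

variable [Finite V]

/-- If an arc `A ⊆ B` shares no endpoint with the arc `B`, then both parts of `B \ A` are
nonempty, and an arc meeting `A` and the complement of `B` has to meet `B \ A`. -/
theorem IsCircularOrdering.meets_sdiff (hσ : IsCircularOrdering σ) {A B : Set V}
    (hA : IsArc σ A) (hB : IsArc σ B) (hAB : A ⊆ B) (hA0 : A.Nonempty) (hB1 : B ≠ Set.univ)
    (hs : ¬ ShareEndpoint σ A B) : (B \ A).Nonempty ∧
      ∀ S, IsArc σ S → (S ∩ A).Nonempty → (S \ B).Nonempty → (S ∩ (B \ A)).Nonempty := by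
  obtain ⟨l, b, hb, hb', rfl⟩ := hσ.exists_iv hB (hA0.mono hAB) hB1
  obtain ⟨p, k, hp, hk, rfl, hmA⟩ := hσ.exists_pow_mem_iff l hA
  have hmB : ∀ j < Nat.card V, ((σ ^ j) l ∈ iv σ l b ↔ j < b) :=
    fun j hj => hσ.pow_mem_iv_self l hb'.le hj
  have hk0 : 0 < k := by
    obtain ⟨v, i, hi, -⟩ := hA0
    omega
  have hpb : p < b := (hmB p hp).1 (hAB ((hmA p hp).2 (by omega)))
  have hpk : p + k ≤ b := by
    by_contra! hc
    have := (hmB b hb').1 (hAB ((hmA b hb').2 (by omega)))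
    omega
  rw [hσ.shareEndpoint_iv_iff hk0 (by omega) hb hb', ← Perm.mul_apply, ← pow_add] at hs
  push Not at hs
  have hp0 : 0 < p := by
    rcases Nat.eq_zero_or_pos p with rfl | h
    · exact absurd rfl hs.1
    · exact h
  have hpk' : p + k < b := by
    refine lt_of_le_of_ne hpk fun h => hs.2.2.2 ?_
    congr 2
    omega
  have h0 : (σ ^ 0) l ∈ iv σ l b \ iv σ ((σ ^ p) l) k :=
    ⟨(hmB 0 (by omega)).2 hb, fun h => by have := (hmA 0 (by omega)).1 h; omega⟩
  have h1 : (σ ^ (p + k)) l ∈ iv σ l b \ iv σ ((σ ^ p) l) k :=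
    ⟨(hmB _ (by omega)).2 hpk', fun h => by have := (hmA _ (by omega)).1 h; omega⟩
  refine ⟨⟨_, h0⟩, fun S hS hSA hSB => ?_⟩
  obtain ⟨q, m, hq, hm, -, hmS⟩ := hσ.exists_pow_mem_iff l hS
  obtain ⟨s, hs1, hs2⟩ := hSA
  obtain ⟨t, ht1, ht2⟩ := hSB
  obtain ⟨i, hi, rfl⟩ := hσ.exists_pow l s
  obtain ⟨j, hj, rfl⟩ := hσ.exists_pow l t
  rw [hmS i hi] at hs1
  rw [hmA i hi] at hs2
  rw [hmS j hj] at ht1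
  rw [hmB j hj] at ht2
  by_cases c0 : (σ ^ 0) l ∈ S
  · exact ⟨_, c0, h0⟩
  · refine ⟨_, ?_, h1⟩
    rw [hmS _ (by omega)] at c0 ⊢
    omega

/-- If the complement of `G` is not bipartite, every arc ordering of the closed neighborhood
hypergraph is tight. -/
theorem isTightArcOrdering_of_not_isBipartite
    (hcl : ∀ v, ∃ K L : Set V, G.IsClique K ∧ G.IsClique L ∧ closedNbhd G v = K ∪ L)
    (hb : ¬ Gᶜ.IsBipartite) (hτ : IsArcOrdering (closedNbhdHypergraph G) τ) :
    IsTightArcOrdering (closedNbhdHypergraph G) τ := by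
  refine ⟨hτ, ?_⟩
  rintro _ ⟨x, rfl⟩ _ ⟨y, rfl⟩ - hxy hy
  by_contra hs
  have harc : ∀ v, IsArc τ (closedNbhd G v) := fun v => hτ.2 _ ⟨v, rfl⟩
  have : Nonempty V := ⟨x⟩
  obtain ⟨⟨d₀, hd₀, hd₀'⟩, hsep⟩ := hτ.1.meets_sdiff (harc x) (harc y) hxy
    ⟨x, self_mem_closedNbhd x⟩ hy hs
  -- Let `D = N[y] \ N[x]`. Applying the separation property to the arc `V \ N[v]` shows: if `N[v]`
  -- contains `D`, it contains all of `N[x]` or everything outside `N[y]`.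
  have sep : ∀ v s t, s ∈ closedNbhd G x → t ∉ closedNbhd G y → s ∉ closedNbhd G v →
      t ∉ closedNbhd G v →
      (∀ d, d ∈ closedNbhd G y → d ∉ closedNbhd G x → d ∈ closedNbhd G v) → False := by
    intro v s t h1 h2 h3 h4 h5
    obtain ⟨d, hd, hd1, hd2⟩ := hsep _ (hτ.1.isArc_compl (harc v)) ⟨s, h3, h1⟩ ⟨t, h4, h2⟩
    exact hd (h5 d hd1 hd2)
  have mem_of_clique : ∀ {K : Set V}, G.IsClique K → ∀ {u v}, u ∈ K → v ∈ K →
      u ∈ closedNbhd G v := by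
    intro K hK u v hu hv
    by_cases huv : u = v
    · exact Or.inl huv
    · exact Or.inr (hK hv hu (Ne.symm huv))
  obtain ⟨K, L, hK, hL, hKL, hxK⟩ : ∃ K L : Set V, G.IsClique K ∧ G.IsClique L ∧
      closedNbhd G y = K ∪ L ∧ x ∈ K := by
    obtain ⟨K, L, hK, hL, hKL⟩ := hcl y
    have hx : x ∈ K ∪ L := hKL ▸ hxy (self_mem_closedNbhd x)
    rcases hx with hx | hx
    · exact ⟨K, L, hK, hL, hKL, hx⟩
    · exact ⟨L, K, hL, hK, by rw [hKL, Set.union_comm], hx⟩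
  have hD : ∀ d, d ∈ closedNbhd G y → d ∉ closedNbhd G x → d ∈ L := by
    intro d h1 h2
    rw [hKL] at h1
    exact h1.resolve_left fun h => h2 (mem_of_clique hK h hxK)
  -- `D` lies in the clique `L`, so `N[d]` contains `D`. It misses `x`, hence contains everything
  -- outside `N[y]`.
  have hDP : ∀ d t, d ∈ closedNbhd G y → d ∉ closedNbhd G x → t ∉ closedNbhd G x →
      t ∈ closedNbhd G d := by
    intro d t h1 h2 h3
    by_cases ht : t ∈ closedNbhd G y
    · exact mem_of_clique hL (hD t ht h3) (hD d h1 h2)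
    · by_contra hc
      exact sep d x t (self_mem_closedNbhd x) ht (fun h => h2 (mem_closedNbhd_comm.1 h)) hc
        fun d' h1' h2' => mem_of_clique hL (hD d' h1' h2') (hD d h1 h2)
  -- `N[d₀]` is a union of two cliques and contains `y`, `c`, `c'`. The clique holding `y` excludes
  -- `c` and `c'`, so both lie in the other.
  have hC : ∀ c c', c ∉ closedNbhd G y → c' ∉ closedNbhd G y → c ∈ closedNbhd G c' := by
    intro c c' hc hc'
    obtain ⟨K', L', hK', hL', h⟩ := hcl d₀
    have m1 : c ∈ K' ∪ L' := h ▸ hDP d₀ c hd₀ hd₀' fun h => hc (hxy h)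
    have m2 : c' ∈ K' ∪ L' := h ▸ hDP d₀ c' hd₀ hd₀' fun h => hc' (hxy h)
    have m3 : y ∈ K' ∪ L' := h ▸ mem_closedNbhd_comm.1 hd₀
    rcases m3 with m3 | m3
    · exact mem_of_clique hL' (m1.resolve_left fun h => hc (mem_of_clique hK' h m3))
        (m2.resolve_left fun h => hc' (mem_of_clique hK' h m3))
    · exact mem_of_clique hK' (m1.resolve_right fun h => hc (mem_of_clique hL' h m3))
        (m2.resolve_right fun h => hc' (mem_of_clique hL' h m3))
  have hf : ∀ f, f ∈ L → (∀ t, t ∉ closedNbhd G y → t ∈ closedNbhd G f) ∨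
      (∀ s, s ∈ closedNbhd G x → s ∈ closedNbhd G f) := by
    intro f hfL
    by_contra! hc
    obtain ⟨⟨t, ht, ht'⟩, s, hs, hs'⟩ := hc
    exact sep f s t hs ht hs' ht' fun d h1 h2 => mem_of_clique hL (hD d h1 h2) hfL
  have hclique : ∀ X : Set V, (∀ u ∈ X, ∀ v ∈ X, u ∈ closedNbhd G v) → G.IsClique X := by
    intro X hX u hu v hv huv
    exact (hX v hv u hu).resolve_left (Ne.symm huv)
  -- By `hf` each vertex of `L` is complete to `V \ N[y]` or to `N[x]`. The first kind joins the
  -- clique `V \ N[x]`, the second joins `K ∩ N[x]`; the resulting two cliques cover `V`.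
  let X : Set V := {v | v ∉ closedNbhd G x ∨
    (v ∈ L ∧ ∀ t, t ∉ closedNbhd G y → t ∈ closedNbhd G v)}
  let Y : Set V := {v | v ∈ closedNbhd G x ∧
    (v ∈ K ∨ ∀ s, s ∈ closedNbhd G x → s ∈ closedNbhd G v)}
  refine hb (isBipartite_compl_of_cliques (K := X) (L := Y) (hclique _ ?_) (hclique _ ?_) ?_)
  · have h1 : ∀ u v, u ∉ closedNbhd G x → v ∉ closedNbhd G x → u ∈ closedNbhd G v := by
      intro u v hu hv
      by_cases hvy : v ∈ closedNbhd G y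
      · exact hDP v u hvy hv hu
      · by_cases huy : u ∈ closedNbhd G y
        · exact mem_closedNbhd_comm.1 (hDP u v huy hu hv)
        · exact hC u v huy hvy
    have h2 : ∀ u v, u ∉ closedNbhd G x → v ∈ L →
        (∀ t, t ∉ closedNbhd G y → t ∈ closedNbhd G v) → u ∈ closedNbhd G v := by
      intro u v hu hv hv'
      by_cases huy : u ∈ closedNbhd G y
      · exact mem_of_clique hL (hD u huy hu) hv
      · exact hv' u huy
    rintro u (hu | ⟨hu, hu'⟩) v (hv | ⟨hv, hv'⟩)
    · exact h1 u v hu hv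
    · exact h2 u v hu hv hv'
    · exact mem_closedNbhd_comm.1 (h2 v u hv hu hu')
    · exact mem_of_clique hL hu hv
  · rintro u ⟨hu, hu'⟩ v ⟨hv, hv'⟩
    rcases hv' with hv' | hv'
    · rcases hu' with hu' | hu'
      · exact mem_of_clique hK hu' hv'
      · exact mem_closedNbhd_comm.1 (hu' v hv)
    · exact hv' u hu
  · rw [Set.eq_univ_iff_forall]
    intro v
    by_cases hv : v ∈ closedNbhd G x
    · have : v ∈ K ∪ L := hKL ▸ hxy hv
      rcases this with h | h
      · exact Or.inr ⟨hv, Or.inl h⟩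
      · rcases hf v h with h' | h'
        · exact Or.inl (Or.inr ⟨h, h'⟩)
        · exact Or.inr ⟨hv, Or.inr h'⟩
    · exact Or.inl (Or.inl hv)

/-- Uniqueness of the arc ordering for graphs with non-bipartite complement. -/
theorem exists_unique_isArcOrdering (htwin : TwinFree G) (hconn : G.Connected) (hpca : IsPCA G)
    (hb : ¬ Gᶜ.IsBipartite) : ∃ σ : Perm V, IsArcOrdering (closedNbhdHypergraph G) σ ∧
      ∀ τ : Perm V, IsArcOrdering (closedNbhdHypergraph G) τ → EqUpToReversal τ σ := by
  have : Nontrivial V := by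
    by_contra hn
    rw [not_nontrivial_iff_subsingleton] at hn
    exact hb ⟨SimpleGraph.Coloring.mk (fun _ => 0) fun {u v} huv =>
      absurd (Subsingleton.elim u v) huv.ne⟩
  obtain ⟨σ, R, h⟩ := hpca.exists_isRound
  have hu : ∀ v, closedNbhd G v ≠ Set.univ := by
    intro v hv
    obtain ⟨K, L, hK, hL, hKL⟩ := h.exists_cliques v
    exact hb (isBipartite_compl_of_cliques hK hL (hKL ▸ hv))
  refine ⟨σ, h.isTightArcOrdering.1, fun τ hτ => ?_⟩
  have tσ := isTightFamily_closedNbhd h.isTightArcOrdering hu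
  have tτ := isTightFamily_closedNbhd
    (isTightArcOrdering_of_not_isBipartite h.exists_cliques hb hτ) hu
  obtain ⟨v₀⟩ := hconn.nonempty
  obtain ⟨g, hg, hfix⟩ := tσ.exists_conj_forall_image_eq tτ (i₀ := v₀)
    ⟨v₀, self_mem_closedNbhd v₀⟩ (hu v₀)
  -- As `g` preserves every closed neighborhood, `v` and `g v` lie in the same ones and are twins.
  have hg1 : g = 1 := by
    ext v
    refine htwin _ _ (Set.ext fun w => ?_)
    rw [mem_closedNbhd_comm, mem_iff_of_image_eq (hfix w (h.reflTransGen_meet hb hconn v₀ w)),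
      mem_closedNbhd_comm]
    rfl
  subst hg1
  simp only [one_mul, inv_one, mul_one] at hg
  rcases hg with hg | hg
  · exact Or.inl hg.symm
  · exact Or.inr (by rw [hg, inv_inv])

end CircArc

/-! ### Connected bipartite complement: two tight orderings -/

namespace CircArc

variable {V : Type*} {G : SimpleGraph V} {σ τ : Perm V}

/-- `U` is one side of a bipartition of the complement of `G`. -/
def IsSide (G : SimpleGraph V) (U : Set V) : Prop :=
  ∀ u v, Gᶜ.Adj u v → (u ∈ U ↔ v ∉ U)

theorem exists_isSide (hb : Gᶜ.IsBipartite) : ∃ U, IsSide G U := by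
  obtain ⟨c⟩ := hb
  refine ⟨{v | c v = 0}, fun u v huv => ?_⟩
  have := c.valid huv
  change c u = 0 ↔ ¬ c v = 0
  omega

theorem induction_of_connected {H : SimpleGraph V} (hH : H.Connected) {P : V → Prop}
    (hP : ∀ a b, H.Adj a b → P a → P b) {u : V} (hu : P u) (v : V) : P v := by
  obtain ⟨p⟩ := hH.preconnected u v
  induction p with
  | nil => exact hu
  | cons hab _ ih => exact ih (hP _ _ hab hu)

theorem exists_adj_of_connected [Nontrivial V] {H : SimpleGraph V} (hH : H.Connected) (v : V) :
    ∃ w, H.Adj v w := by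
  by_contra! hc
  obtain ⟨w, hw⟩ := exists_ne v
  exact hw (induction_of_connected hH (P := fun w => w = v)
    (fun a b hab ha => absurd (ha ▸ hab) (hc b)) rfl w)

namespace IsSide

variable {U : Set V}

theorem compl (hU : IsSide G U) : IsSide G Uᶜ := by
  intro u v huv
  have := hU u v huv
  simp only [Set.mem_compl_iff]
  tauto

theorem mem_closedNbhd (hU : IsSide G U) {u v : V} (huv : u ∈ U ↔ v ∈ U) :
    u ∈ closedNbhd G v := by
  by_contra hc
  have := hU v u (notMem_closedNbhd.1 hc)
  tauto

/-- Two vertices of `U` with a common non-neighbor have meeting neighborhoods: both contain the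
clique `U` and both miss that non-neighbor. Walks in the complement chain such pairs. -/
theorem reflTransGen_meet (hU : IsSide G U) (hH : Gᶜ.Connected) {u v : V} (hu : u ∈ U)
    (hv : v ∈ U) : Relation.ReflTransGen (Meet (closedNbhd G)) u v := by
  have key := induction_of_connected hH
    (P := fun w => (w ∈ U ∧ Relation.ReflTransGen (Meet (closedNbhd G)) u w) ∨
      (w ∉ U ∧ ∃ z ∈ U, Relation.ReflTransGen (Meet (closedNbhd G)) u z ∧ Gᶜ.Adj z w))
    ?_ (Or.inl ⟨hu, Relation.ReflTransGen.refl⟩) v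
  · rcases key with h | h
    · exact h.2
    · exact absurd hv h.1
  · rintro a b hab (⟨ha, h⟩ | ⟨ha, z, hz, h, hza⟩)
    · exact Or.inr ⟨(hU a b hab).1 ha, a, ha, h, hab⟩
    · have hb : b ∈ U := by
        have := hU a b hab
        tauto
      refine Or.inl ⟨hb, h.tail ⟨⟨z, self_mem_closedNbhd z, ?_⟩, fun hu' => ?_⟩⟩
      · exact hU.mem_closedNbhd (by tauto)
      · have : a ∈ closedNbhd G z ∪ closedNbhd G b := hu' ▸ Set.mem_univ a
        rcases this with h' | h'
        · exact notMem_closedNbhd.2 hza h'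
        · exact notMem_closedNbhd.2 hab.symm h'

/-- Since `Uᶜ` is a clique, a vertex there is determined by its neighbors in `U`, and `g` preserves
these. A non-neighbor of `v` in `U` shows that `g v` stays outside `U`. -/
theorem apply_eq_self [Nontrivial V] (hU : IsSide G U) (hH : Gᶜ.Connected) (htwin : TwinFree G)
    {g : Perm V} (hg : ∀ u ∈ U, g '' closedNbhd G u = closedNbhd G u) {v : V} (hv : v ∉ U) :
    g v = v := by
  obtain ⟨u, hvu⟩ := exists_adj_of_connected hH v
  have hu : u ∈ U := by
    have := hU v u hvu
    tauto
  have hgv : g v ∉ U := by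
    have h1 : v ∉ closedNbhd G u := notMem_closedNbhd.2 hvu.symm
    rw [← mem_iff_of_image_eq (hg u hu)] at h1
    exact (hU u _ (notMem_closedNbhd.1 h1)).1 hu
  refine htwin _ _ (Set.ext fun w => ?_)
  by_cases hw : w ∈ U
  · rw [mem_closedNbhd_comm, mem_iff_of_image_eq (hg w hw), mem_closedNbhd_comm]
  · simp only [hU.mem_closedNbhd (u := w) (v := g v) (by tauto),
      hU.mem_closedNbhd (u := w) (v := v) (by tauto)]

/-- If `U` had at most one vertex, every vertex of `Uᶜ` would be non-adjacent to it. Those vertices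
would be twins, so `G` would have no edge. -/
theorem nontrivial [Nontrivial V] (hU : IsSide G U) (hG : G.Connected) (hH : Gᶜ.Connected)
    (htwin : TwinFree G) : U.Nontrivial := by
  by_contra hs
  rw [Set.not_nontrivial_iff] at hs
  have hmem : ∀ u w, u ∈ U → w ∉ U → Gᶜ.Adj w u := by
    intro u w hu hw
    obtain ⟨u', hu'⟩ := exists_adj_of_connected hH w
    have : u' ∈ U := by
      have := hU w u' hu'
      tauto
    rwa [hs hu this]
  obtain ⟨v₀⟩ := hG.nonempty
  have hsub : ∀ w w', w ∉ U → w' ∉ U → w = w' := by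
    intro w w' hw hw'
    refine htwin _ _ (Set.ext fun v => ?_)
    by_cases hv : v ∈ U
    · simp only [notMem_closedNbhd.2 (hmem v w hv hw), notMem_closedNbhd.2 (hmem v w' hv hw')]
    · simp only [hU.mem_closedNbhd (u := v) (v := w) (by tauto),
        hU.mem_closedNbhd (u := v) (v := w') (by tauto)]
  obtain ⟨v, hv⟩ := exists_adj_of_connected hG v₀
  by_cases h0 : v₀ ∈ U <;> by_cases h1 : v ∈ U
  · exact hv.ne (hs h0 h1)
  · exact ((SimpleGraph.compl_adj ..).1 (hmem _ _ h0 h1)).2 hv.symm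
  · exact ((SimpleGraph.compl_adj ..).1 (hmem _ _ h1 h0)).2 hv
  · exact hv.ne (hsub _ _ h0 h1)

/-- The non-neighborhoods of vertices of `U` are arcs inside `Uᶜ`. A maximal arc inside `Uᶜ` absorbs
each one it touches, and connectedness of the complement makes it all of `Uᶜ`. -/
theorem isArc_compl [Finite V] [Nontrivial V] (hU : IsSide G U) (hH : Gᶜ.Connected)
    (hU0 : U.Nonempty) (hσ : IsArcOrdering (closedNbhdHypergraph G) σ) : IsArc σ Uᶜ := by
  have hM : ∀ v, IsArc σ (closedNbhd G v)ᶜ := fun v => hσ.1.isArc_compl (hσ.2 _ ⟨v, rfl⟩)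
  have hMU : ∀ u ∈ U, (closedNbhd G u)ᶜ ⊆ Uᶜ := fun u hu v hv =>
    (hU u v (notMem_closedNbhd.1 hv)).1 hu
  obtain ⟨u₀, hu₀⟩ := hU0
  obtain ⟨w₀, hw₀⟩ := exists_adj_of_connected hH u₀
  obtain ⟨S, ⟨hS, hS0, hSU⟩, hmax⟩ :=
    (Set.toFinite {S : Set V | IsArc σ S ∧ S.Nonempty ∧ S ⊆ Uᶜ}).exists_maximal
      ⟨_, hM u₀, ⟨w₀, notMem_closedNbhd.2 hw₀⟩, hMU u₀ hu₀⟩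
  have hclosed : ∀ u ∈ U, ((closedNbhd G u)ᶜ ∩ S).Nonempty → (closedNbhd G u)ᶜ ⊆ S := by
    intro u hu hne
    have h1 : IsArc σ ((closedNbhd G u)ᶜ ∪ S) := hσ.1.isArc_union (hM u) hS hne
    exact Set.subset_union_left.trans (hmax ⟨h1, hS0.mono Set.subset_union_right,
      Set.union_subset (hMU u hu) hSU⟩ Set.subset_union_right)
  obtain ⟨s, hs⟩ := hS0
  have key := induction_of_connected hH
    (P := fun w => w ∈ S ∨ (w ∈ U ∧ ((closedNbhd G w)ᶜ ∩ S).Nonempty)) ?_ (Or.inl hs)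
  · have : Uᶜ = S := Set.Subset.antisymm (fun w hw => (key w).resolve_right fun h => hw h.1) hSU
    rwa [this]
  · rintro a b hab (ha | ⟨ha, hne⟩)
    · refine Or.inr ⟨?_, a, notMem_closedNbhd.2 hab.symm, ha⟩
      have h1 : a ∉ U := hSU ha
      have := hU a b hab
      tauto
    · exact Or.inl (hclosed a ha hne (notMem_closedNbhd.2 hab))

end IsSide

/-- An automorphism of a circular ordering that preserves a nonempty proper arc is trivial. -/
theorem IsCircularOrdering.eq_one_of_image_eq [Finite V] (hσ : IsCircularOrdering σ) {U : Set V}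
    (hU : IsArc σ U) (h0 : U.Nonempty) (h1 : U ≠ Set.univ) {g : Perm V}
    (hg : g * σ * g⁻¹ = σ) (hgU : g '' U = U) : g = 1 := by
  have : Nonempty V := ⟨h0.some⟩
  obtain ⟨l, b, hb, hb', rfl⟩ := hσ.exists_iv hU h0 h1
  rw [← iv_conj, hg] at hgU
  obtain ⟨hl, -⟩ := hσ.iv_inj hb hb' hb' hgU
  obtain ⟨k, -, rfl⟩ := hσ.eq_pow_of_commute (mul_inv_eq_iff_eq_mul.1 hg)
  ext v
  have hk := (hσ.pow_eq_pow_iff l (i := k) (j := 0)).1 hl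
  exact (hσ.pow_eq_pow_iff v (j := 0)).2 hk

theorem image_eq_of_mem_iff {g : Perm V} {A : Set V} (h : ∀ v, g v ∈ A ↔ v ∈ A) :
    g '' A = A := by
  ext v
  obtain ⟨w, rfl⟩ := g.surjective v
  rw [g.injective.mem_set_image, h]

theorem exists_perm_eqOn (ρ : Perm V) {U : Set V} (h : ∀ v, ρ v ∈ U ↔ v ∈ U) :
    ∃ π : Perm V, (∀ v ∈ U, π v = ρ v) ∧ ∀ v ∉ U, π v = v := by
  classical
  refine ⟨Perm.ofSubtype (ρ.subtypePerm (p := (· ∈ U)) h), fun v hv => ?_, fun v hv => ?_⟩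
  · exact Perm.ofSubtype_apply_of_mem _ hv
  · exact Perm.ofSubtype_apply_of_not_mem _ hv

/-- Reversing one side of the bipartition only transforms a tight arc ordering into a tight arc
ordering. -/
theorem IsSide.isTightArcOrdering_conj [Finite V] {U : Set V} (hU : IsSide G U)
    (h : IsTightArcOrdering (closedNbhdHypergraph G) σ) {ρ π : Perm V}
    (hρ : ρ * σ * ρ⁻¹ = σ⁻¹) (hρU : ∀ v, ρ v ∈ U ↔ v ∈ U) (hπU : ∀ v ∈ U, π v = ρ v)
    (hπ : ∀ v ∉ U, π v = v) :
    IsTightArcOrdering (closedNbhdHypergraph G) (π * σ * π⁻¹) := by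
  have hσ : ρ⁻¹ * σ⁻¹ * ρ⁻¹⁻¹ = σ := by rw [← hρ]; group
  have hρU' : ∀ v, ρ⁻¹ v ∈ U ↔ v ∈ U := fun v => by rw [← hρU, Perm.inv_def, Equiv.apply_symm_apply]
  have hπmem : ∀ v, π v ∈ U ↔ v ∈ U := by
    intro v
    by_cases hv : v ∈ U
    · rw [hπU v hv, hρU]
    · rw [hπ v hv]
  -- For `x ∈ U` the neighborhood contains `U`, and `π` moves only points within `U`. For `x ∉ U` it
  -- contains `Uᶜ`, and `π * ρ⁻¹` moves only points there; as `ρ⁻¹` carries `σ⁻¹` to `σ`, arcs of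
  -- `σ⁻¹` can be used.
  have img : ∀ x ∈ U, π '' closedNbhd G x = closedNbhd G x := by
    refine fun x hx => image_eq_of_mem_iff fun v => ?_
    by_cases hv : v ∈ U
    · simp only [hU.mem_closedNbhd (u := π v) (v := x) (by simp [hπmem, hv, hx]),
        hU.mem_closedNbhd (u := v) (v := x) (by tauto)]
    · rw [hπ v hv]
  have img' : ∀ x ∉ U, π '' (⇑(ρ⁻¹) '' closedNbhd G x) = closedNbhd G x := by
    intro x hx
    rw [← Set.image_comp, ← Perm.coe_mul]
    refine image_eq_of_mem_iff fun v => ?_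
    rw [Perm.mul_apply]
    by_cases hv : v ∈ U
    · rw [hπU _ ((hρU' v).2 hv), Perm.inv_def, Equiv.apply_symm_apply]
    · simp only [hU.mem_closedNbhd (u := π (ρ⁻¹ v)) (v := x) (by simp only [hπmem, hρU']; tauto),
        hU.mem_closedNbhd (u := v) (v := x) (by tauto)]
  refine ⟨⟨h.1.1.conj π, ?_⟩, ?_⟩
  · rintro _ ⟨x, rfl⟩
    have hx := h.1.2 _ ⟨x, rfl⟩
    by_cases hxU : x ∈ U
    · rw [← img x hxU]
      exact hx.conj π
    · rw [← img' x hxU]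
      have := (h.1.1.isArc_inv hx).conj ρ⁻¹
      rw [hσ] at this
      exact this.conj π
  · rintro _ ⟨x, rfl⟩ _ ⟨y, rfl⟩ hne hxy hy
    have hs := h.2 _ ⟨x, rfl⟩ _ ⟨y, rfl⟩ hne hxy hy
    -- The common non-neighbor `z` puts `x` and `y` on the same side, so one map serves both.
    obtain ⟨z, hz⟩ := (Set.ne_univ_iff_exists_notMem _).1 hy
    have h1 := hU y z (notMem_closedNbhd.1 hz)
    have h2 := hU x z (notMem_closedNbhd.1 fun h => hz (hxy h))
    by_cases hxU : x ∈ U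
    · rw [← img x hxU, ← img y (by tauto)]
      exact hs.conj π
    · rw [← img' x hxU, ← img' y (by tauto)]
      have := (h.1.1.shareEndpoint_inv hs).conj ρ⁻¹
      rw [hσ] at this
      exact this.conj π

/-- The two tight arc orderings for graphs with connected bipartite complement. -/
theorem exists_two_isTightArcOrdering [Finite V] [Nontrivial V] (htwin : TwinFree G)
    (hconn : G.Connected) (hpca : IsPCA G) (hb : Gᶜ.IsBipartite) (hH : Gᶜ.Connected) :
    ∃ σ₁ σ₂ : Perm V,
      IsTightArcOrdering (closedNbhdHypergraph G) σ₁ ∧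
      IsTightArcOrdering (closedNbhdHypergraph G) σ₂ ∧
      ¬ EqUpToReversal σ₁ σ₂ ∧
      ∀ τ : Perm V, IsTightArcOrdering (closedNbhdHypergraph G) τ →
        EqUpToReversal τ σ₁ ∨ EqUpToReversal τ σ₂ := by
  obtain ⟨σ, R, hR⟩ := hpca.exists_isRound
  have hσ := hR.isTightArcOrdering
  have hc := hσ.1.1
  obtain ⟨U, hU⟩ := exists_isSide hb
  have nU := hU.nontrivial hconn hH htwin
  have nW := hU.compl.nontrivial hconn hH htwin
  have arcU : IsArc σ U := by
    have := hU.compl.isArc_compl hH nW.nonempty hσ.1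
    rwa [compl_compl] at this
  have hU1 : U ≠ Set.univ := by
    rw [Set.ne_univ_iff_exists_notMem]
    exact nW.nonempty
  have hu : ∀ v, closedNbhd G v ≠ Set.univ := fun v => by
    obtain ⟨w, hw⟩ := exists_adj_of_connected hH v
    exact (Set.ne_univ_iff_exists_notMem _).2 ⟨w, notMem_closedNbhd.2 hw⟩
  obtain ⟨l, b, hb0, hb1, hUe⟩ := hc.exists_iv arcU nU.nonempty hU1
  obtain ⟨ρ, hρ, hρl, hshift⟩ := hc.exists_reflection l hb0 hb1
  have hρU : ∀ v, ρ v ∈ U ↔ v ∈ U := by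
    have := (hshift 0 0 hb0 (by omega)).1
    rw [Nat.sub_zero (Nat.card V), hc.pow_card] at this
    refine mem_iff_of_image_eq ?_
    rw [hUe]; exact this
  obtain ⟨π, hπU, hπ⟩ := exists_perm_eqOn ρ hρU
  have hπmem : ∀ v, π v ∈ U ↔ v ∈ U := by
    intro v
    by_cases hv : v ∈ U
    · rw [hπU v hv, hρU]
    · rw [hπ v hv]
  have memU : ∀ j < Nat.card V, ((σ ^ j) l ∈ U ↔ j < b) := fun j hj => by
    rw [hUe, hc.pow_mem_iv_self l hb1.le hj]
  have hb2 : 1 < b := by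
    by_contra! hle
    obtain ⟨u, hu, v, hv, huv⟩ := nU
    obtain ⟨i, hi, rfl⟩ := hc.exists_pow l u
    obtain ⟨j, hj, rfl⟩ := hc.exists_pow l v
    rw [memU i hi] at hu
    rw [memU j hj] at hv
    exact huv (by rw [show i = j by omega])
  have hb3 : b + 1 < Nat.card V := by
    by_contra! hle
    obtain ⟨u, hu, v, hv, huv⟩ := nW
    obtain ⟨i, hi, rfl⟩ := hc.exists_pow l u
    obtain ⟨j, hj, rfl⟩ := hc.exists_pow l v
    rw [Set.mem_compl_iff, memU i hi] at hu
    rw [Set.mem_compl_iff, memU j hj] at hv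
    exact huv (by rw [show i = j by omega])
  -- A side-preserving permutation is determined by the ordering it produces, because rotations
  -- preserving the proper arc `U` are trivial.
  have rigid : ∀ a b : Perm V, a * σ * a⁻¹ = b * σ * b⁻¹ → (∀ v, a v ∈ U ↔ v ∈ U) →
      (∀ v, b v ∈ U ↔ v ∈ U) → a = b := by
    intro a b hab ha hb
    have h1 : b⁻¹ * a = 1 := by
      apply hc.eq_one_of_image_eq arcU nU.nonempty hU1
      · calc b⁻¹ * a * σ * (b⁻¹ * a)⁻¹ = b⁻¹ * (a * σ * a⁻¹) * b := by group
          _ = σ := by rw [hab]; group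
      · refine image_eq_of_mem_iff fun v => ?_
        rw [← hb, Perm.mul_apply, Perm.inv_def, Equiv.apply_symm_apply, ha]
    exact (inv_mul_eq_one.1 h1).symm
  refine ⟨σ, π * σ * π⁻¹, hσ, hU.isTightArcOrdering_conj hσ hρ hρU hπU hπ, ?_, fun τ hτ => ?_⟩
  -- Equality would give `π = 1`, but `π` swaps the ends of `U`, which differ as `1 < b`. Equality
  -- with the reversal would give `π = ρ`, but `ρ` moves the first point after `U`, as `Uᶜ` has at
  -- least two points.
  · rintro (he | he)
    · have h1 : π = 1 := rigid π 1 (by rw [← he]; group) hπmem fun v => Iff.rfl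
      have hlU : l ∈ U := (memU 0 (by omega)).2 hb0
      have h2 := hπU l hlU
      rw [h1, hρl] at h2
      have := hc.pow_inj l (i := 0) (j := b - 1) (by omega) (by omega) h2
      omega
    · have h1 : π = ρ := rigid π ρ (by rw [hρ]; conv_rhs => rw [he]
                                       rw [inv_inv]) hπmem hρU
      have hv : (σ ^ b) l ∉ U := by rw [memU b hb1]; omega
      have h2 := hπ _ hv
      rw [h1, ← conj_pow_apply, hρ, hρl, inv_pow, Perm.inv_eq_iff_eq, ← Perm.mul_apply, ← pow_add,
        hc.pow_eq_pow_iff] at h2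
      have := IsCircularOrdering.eq_or_of_modEq h2 (by omega) (by omega)
      omega
  · have tσ := isTightFamily_closedNbhd hσ hu
    have tτ := isTightFamily_closedNbhd hτ hu
    obtain ⟨u₀, hu₀⟩ := nU.nonempty
    obtain ⟨w₀, hw₀⟩ := nW.nonempty
    obtain ⟨g, hg, gfix⟩ := tσ.exists_conj_forall_image_eq tτ (i₀ := u₀)
      ⟨u₀, self_mem_closedNbhd u₀⟩ (hu u₀)
    obtain ⟨h, hh, hfix⟩ := tσ.exists_conj_forall_image_eq tτ (i₀ := w₀)
      ⟨w₀, self_mem_closedNbhd w₀⟩ (hu w₀)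
    have gW : ∀ v ∉ U, g v = v := fun v hv => hU.apply_eq_self hH htwin
      (fun u hu => gfix u (hU.reflTransGen_meet hH hu₀ hu)) hv
    have hUfix : ∀ v ∈ U, h v = v := fun v hv => hU.compl.apply_eq_self hH htwin
      (fun u hu => hfix u (hU.compl.reflTransGen_meet hH hw₀ hu)) (by simpa using hv)
    have gU : ∀ v, g v ∈ U ↔ v ∈ U := by
      intro v
      by_cases hv : v ∈ U
      · refine iff_of_true ?_ hv
        by_contra hgv
        exact hgv (by rwa [g.injective (gW _ hgv)])
      · rw [gW v hv]
    have hU' : ∀ v, h v ∈ U ↔ v ∈ U := by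
      intro v
      by_cases hv : v ∈ U
      · rw [hUfix v hv]
      · refine iff_of_false (fun hhv => hv ?_) hv
        rwa [h.injective (hUfix _ hhv)] at hhv
    have htwo : h * σ * h⁻¹ = g * σ * g⁻¹ ∨ h * σ * h⁻¹ = (g * σ * g⁻¹)⁻¹ := by
      rcases hg with hg | hg <;> rcases hh with hh | hh <;> simp [hg, hh]
    -- If `g` and `h` give the same ordering, then `g = h` fixes both sides. If they give opposite
    -- ones, `g = h * ρ`, which is `ρ` on `U` and the identity off `U`, that is, `π`.
    have hT : g * σ * g⁻¹ = σ ∨ g * σ * g⁻¹ = π * σ * π⁻¹ := by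
      rcases htwo with h1 | h1
      · left
        have hgh : g = h := rigid g h h1.symm gU hU'
        have hg1 : g = 1 := by
          ext v
          by_cases hv : v ∈ U
          · rw [hgh, hUfix v hv]; rfl
          · rw [gW v hv]; rfl
        rw [hg1]; group
      · right
        have h2 : g = h * ρ := by
          apply rigid g (h * ρ) _ gU fun v => by rw [Perm.mul_apply, hU', hρU]
          calc g * σ * g⁻¹ = (h * σ * h⁻¹)⁻¹ := by rw [h1, inv_inv]
            _ = h * σ⁻¹ * h⁻¹ := by group
            _ = h * ρ * σ * (h * ρ)⁻¹ := by rw [← hρ]; group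
        have hgπ : g = π := by
          ext v
          by_cases hv : v ∈ U
          · rw [h2, Perm.mul_apply, hUfix _ ((hρU v).2 hv), hπU v hv]
          · rw [gW v hv, hπ v hv]
        rw [hgπ]
    have hτT : EqUpToReversal τ (g * σ * g⁻¹) := by
      rcases hg with hg | hg
      · exact Or.inl hg.symm
      · exact Or.inr (by rw [hg, inv_inv])
    rcases hT with hT | hT
    · exact Or.inl (hT ▸ hτT)
    · exact Or.inr (hT ▸ hτT)

end CircArc

theorem mainTheorem3 {V : Type*} [Finite V] (G : SimpleGraph V)
    (htwin : CircArc.TwinFree G) (hconn : G.Connected) (hpca : CircArc.IsPCA G) :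
    (¬ Gᶜ.IsBipartite →
      ∃ σ : Equiv.Perm V,
        CircArc.IsArcOrdering (CircArc.closedNbhdHypergraph G) σ ∧
        ∀ τ : Equiv.Perm V, CircArc.IsArcOrdering (CircArc.closedNbhdHypergraph G) τ →
          CircArc.EqUpToReversal τ σ) ∧
    (Nontrivial V → Gᶜ.IsBipartite → Gᶜ.Connected →
      ∃ σ₁ σ₂ : Equiv.Perm V,
        CircArc.IsTightArcOrdering (CircArc.closedNbhdHypergraph G) σ₁ ∧
        CircArc.IsTightArcOrdering (CircArc.closedNbhdHypergraph G) σ₂ ∧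
        ¬ CircArc.EqUpToReversal σ₁ σ₂ ∧
        ∀ τ : Equiv.Perm V, CircArc.IsTightArcOrdering (CircArc.closedNbhdHypergraph G) τ →
          CircArc.EqUpToReversal τ σ₁ ∨ CircArc.EqUpToReversal τ σ₂) :=
  ⟨CircArc.exists_unique_isArcOrdering htwin hconn hpca,
    fun _ hb hH => CircArc.exists_two_isTightArcOrdering htwin hconn hpca hb hH⟩
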